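/- Let $A$ be an $n\times n$ symmetrisable generalised Cartan matrix with a realisation $(\mathfrak h,\Pi,\Pi^\vee)$ over $\mathbb C$, simple roots $\alpha_i\in\mathfrak h^*$, simple coroots $\alpha_i^\vee\in\mathfrak h$ and coroot lattice $Q^\vee=\sum_i\mathbb Z\alpha_i^\vee$. Let $W$ be its Weyl group, generated by the set $\mathcal S$ of simple reflections, with length function $\ell$ and Bruhat order $\le$. Let $k$ be a local commutative ring in which $2$ is invertible, $Y_k=Q^\vee\otimes_{\mathbb Z}k$, and $S_k=\mathrm{Sym}(Y_k)$, graded with $Y_k$ in degree $2$. All $S_k$-modules are finitely generated and $\mathbb Z$-graded, and all their morphisms are of degree $0$. For $w\in W$ let $\mathcal G_w$ be the moment graph on $Q^\vee$ with vertices $\{x\in W: x\le w\}$, ordered by $\le$, with an edge $x\to y$ whenever $x<y$ and $yx^{-1}=s_\alpha$ is the reflection in a positive real root $\alpha$, and with label $l(x\to y)=\alpha^\vee$. A $k$-sheaf $\mathcal F$ on $\mathcal G_w$ consists of $S_k$-modules $\mathcal F^x$ for all vertices $x$, $S_k$-modules $\mathcal F^E$ with $l(E)\mathcal F^E=0$ for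 all edges $E$, and homomorphisms $\rho_{x,E}:\mathcal F^x\to\mathcal F^E$ for every vertex $x$ of an edge $E$. The Braden–MacPherson sheaf $\mathcal B_w$ is the indecomposable $k$-sheaf on $\mathcal G_w$ (unique up to isomorphism) such that - $\mathcal B_w^w\cong S_k$; - for every edge $E:x\to y$ the map $\rho_{y,E}$ is surjective with kernel $l(E)\mathcal B_w^y$; - for every vertex $x$ with at least one outgoing edge, the map $(\rho_{x,E})_E:\mathcal B_w^x\to\bigoplus_{E:x\to y}\mathcal B_w^E$ is a projective cover, in the category of graded $S_k$-modules, of its submodule $\mathcal B_w^{\delta x}$. Here $\mathcal B_w^{\delta x}$ is the set of all $(\rho_{y,E}(m_y))_{E:x\to y}$, where $(m_z)_{z>x}$ runs over the sections of $\mathcal B_w$ on $\{z: x<z\le w\}$, that is, the families in $\prod_{x<z\le w}\mathcal B_w^z$ with $\rho_{z,E}(m_z)=\rho_{z',E}(m_{z'})$ for all edges $E:z\to z'$ with $z>x$. **Theorem.** Let $y,w\in W$ with $y\le w$, and let $k$ be any ring as above. (i) $y^{-1}\le w^{-1}$, and $\mathcal B_w^y\cong\mathcal B_{w^{-1}}^{y^{-1}}$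 as graded $S_k$-modules. (ii) If $s\in\mathcal S$ satisfies $ws<w$ and $y\not\le ws$, then $ys\le ws$, and $\mathcal B_w^y\cong\mathcal B_{ws}^{ys}$ as graded $S_k$-modules. -/

import Mathlib

open scoped TensorProduct

universe u v

namespace MomentSheaf

noncomputable section

/-! ### Moment graphs -/

/-- A moment graph on the lattice `Y` with vertex set the poset `V`.  There are no multiple
edges, so the edges are given by a relation: `G.Edge x y` means that there is an edge `x → y`. -/
structure MomentGraph (Y : Type v) [AddCommGroup Y] (V : Type*) [PartialOrder V] where
  Edge : V → V → Prop
  acyclic : ∀ x, ¬ Relation.TransGen Edge x x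
  le_of_edge : ∀ {x y}, Edge x y → x ≤ y
  label : ∀ {x y}, Edge x y → Y
  label_ne_zero : ∀ {x y} (h : Edge x y), label h ≠ 0

/-- The full moment subgraph on a set `I` of vertices. -/
def MomentGraph.restrict {Y : Type v} [AddCommGroup Y] {V : Type*} [PartialOrder V]
    (G : MomentGraph Y V) (I : Set V) : MomentGraph Y I where
  Edge x y := G.Edge x y
  acyclic x hx := G.acyclic x (hx.lift Subtype.val fun _ _ h => h)
  le_of_edge h := G.le_of_edge h
  label h := G.label h
  label_ne_zero h := G.label_ne_zero h

/-! ### The graded algebra `S_k` and graded modules over it -/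

section Graded

variable (k : Type u) [CommRing k] (Y : Type v) [AddCommGroup Y]

/-- `S_k = Sym (Y_k)`, where `Y_k = k ⊗ Y`. -/
abbrev SymAlg : Type (max u v) := SymmetricAlgebra k (k ⊗[ℤ] Y)

/-- The image in `S_k` of an element of the lattice `Y`. -/
def latticeToSym (l : Y) : SymAlg k Y := SymmetricAlgebra.ι k (k ⊗[ℤ] Y) (1 ⊗ₜ[ℤ] l)

/-- The homogeneous component of degree `i` of `S_k`, with `Y_k` placed in degree `2`: it is the
`d`-th symmetric power of `Y_k` if `i = 2 d` with `d ≥ 0`, and zero otherwise. -/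
def symDeg (i : ℤ) : Submodule k (SymAlg k Y) :=
  ⨆ (d : ℕ) (_ : i = 2 * (d : ℤ)), LinearMap.range (SymmetricAlgebra.ι k (k ⊗[ℤ] Y)) ^ d

/-- A finitely generated `ℤ`-graded `S_k`-module. -/
structure GradedMod where
  carrier : Type (max u v)
  [addCommGroup : AddCommGroup carrier]
  [module : Module (SymAlg k Y) carrier]
  [finite : Module.Finite (SymAlg k Y) carrier]
  deg : ℤ → AddSubgroup carrier
  isInternal : DirectSum.IsInternal deg
  smul_mem : ∀ {i j : ℤ} {s : SymAlg k Y} {m : carrier},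
    s ∈ symDeg k Y i → m ∈ deg j → s • m ∈ deg (i + j)

end Graded

namespace GradedMod

variable {k : Type u} [CommRing k] {Y : Type v} [AddCommGroup Y]

instance : CoeSort (GradedMod k Y) (Type (max u v)) := ⟨GradedMod.carrier⟩

attribute [instance] GradedMod.addCommGroup GradedMod.module GradedMod.finite

/-- An `S_k`-linear map is a morphism of graded modules if it is of degree zero. -/
def IsDegZero {M N : GradedMod k Y} (f : M →ₗ[SymAlg k Y] N) : Prop :=
  ∀ (i : ℤ) (m : M), m ∈ M.deg i → f m ∈ N.deg i

/-- `M` and `N` are isomorphic as graded `S_k`-modules. -/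
def Isomorphic (M N : GradedMod k Y) : Prop :=
  ∃ e : M ≃ₗ[SymAlg k Y] N, ∀ (i : ℤ) (m : M), m ∈ M.deg i ↔ e m ∈ N.deg i

/-- `M` is isomorphic to `S_k` as a graded `S_k`-module. -/
def IsomorphicToSym (M : GradedMod k Y) : Prop :=
  ∃ e : M ≃ₗ[SymAlg k Y] SymAlg k Y, ∀ (i : ℤ) (m : M), m ∈ M.deg i ↔ e m ∈ symDeg k Y i

/-- A submodule is homogeneous (graded) if it is generated by homogeneous elements. -/
def IsHomogeneous (M : GradedMod k Y) (N : Submodule (SymAlg k Y) M) : Prop :=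
  Submodule.span (SymAlg k Y) {m : M | m ∈ N ∧ ∃ i, m ∈ M.deg i} = N

/-- Projective objects of the category of (finitely generated) graded `S_k`-modules. -/
def IsProjective (P : GradedMod k Y) : Prop :=
  ∀ (M N : GradedMod k Y) (g : M →ₗ[SymAlg k Y] N) (f : P →ₗ[SymAlg k Y] N),
    IsDegZero g → Function.Surjective g → IsDegZero f →
      ∃ f' : P →ₗ[SymAlg k Y] M, IsDegZero f' ∧ g ∘ₗ f' = f

/-- Let `f : P → T` be linear, with homogeneous kernel, and let `M ⊆ T` be a submodule.
This says that `f` is a projective cover of `M` in the category of graded `S_k`-modules: `P` is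
projective, `f` maps `P` onto `M`, and `ker f` is superfluous, i.e. the only homogeneous
submodule `N` of `P` with `N + ker f = P` is `P` itself. -/
structure IsProjectiveCover (P : GradedMod k Y) {T : Type*} [AddCommGroup T]
    [Module (SymAlg k Y) T] (f : P →ₗ[SymAlg k Y] T) (M : Submodule (SymAlg k Y) T) : Prop where
  projective : P.IsProjective
  range_eq : LinearMap.range f = M
  superfluous : ∀ N : Submodule (SymAlg k Y) P,
    P.IsHomogeneous N → N ⊔ LinearMap.ker f = ⊤ → N = ⊤

end GradedMod

/-! ### Sheaves on moment graphs -/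

section Sheaves

variable (k : Type u) [CommRing k] {Y : Type v} [AddCommGroup Y] {V : Type*} [PartialOrder V]

/-- A `k`-sheaf on the moment graph `G`.  For an edge `E : x → y`, the two restriction maps
`ρ_{x,E}` and `ρ_{y,E}` are `resSource` and `resTarget`. -/
structure Sheaf (G : MomentGraph Y V) where
  stalk : V → GradedMod k Y
  edgeStalk : ∀ {x y}, G.Edge x y → GradedMod k Y
  label_smul : ∀ {x y} (h : G.Edge x y) (m : edgeStalk h), latticeToSym k Y (G.label h) • m = 0
  resSource : ∀ {x y} (h : G.Edge x y), stalk x →ₗ[SymAlg k Y] edgeStalk h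
  resTarget : ∀ {x y} (h : G.Edge x y), stalk y →ₗ[SymAlg k Y] edgeStalk h
  resSource_degZero : ∀ {x y} (h : G.Edge x y), GradedMod.IsDegZero (resSource h)
  resTarget_degZero : ∀ {x y} (h : G.Edge x y), GradedMod.IsDegZero (resTarget h)

end Sheaves

namespace Sheaf

variable {k : Type u} [CommRing k] {Y : Type v} [AddCommGroup Y] {V : Type*} [PartialOrder V]
  {G : MomentGraph Y V}

/-- The module `Γ(I, F)` of sections of `F` over a set `I` of vertices. -/
def sections (F : Sheaf k G) (I : Set V) : Submodule (SymAlg k Y) (∀ x : I, F.stalk x) where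
  carrier := {m | ∀ (x y : I) (h : G.Edge x y), F.resSource h (m x) = F.resTarget h (m y)}
  add_mem' ha hb x y h := by simp [ha x y h, hb x y h]
  zero_mem' x y h := by simp
  smul_mem' c m hm x y h := by simp [hm x y h]

/-- `⨁_{E : x → y} F^E`, the sum over all edges that start at `x` (a finite set in a finite
moment graph). -/
abbrev OutEdges (F : Sheaf k G) (x : V) : Type _ :=
  ∀ e : {y : V // G.Edge x y}, F.edgeStalk e.2

/-- The map `d_x : F^x → ⨁_{E : x → y} F^E`. -/
def toOutEdges (F : Sheaf k G) (x : V) : F.stalk x →ₗ[SymAlg k Y] F.OutEdges x :=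
  LinearMap.pi fun e => F.resSource e.2

theorem lt_of_edge {x y : V} (h : G.Edge x y) : x < y :=
  lt_of_le_of_ne (G.le_of_edge h) fun e => by
    subst e
    exact G.acyclic _ (.single h)

/-- The map `u_x : Γ({> x}, F) → ⨁_{E : x → y} F^E`, induced by the maps `ρ_{y,E}`. -/
def sectionsToOutEdges (F : Sheaf k G) (x : V) :
    F.sections (Set.Ioi x) →ₗ[SymAlg k Y] F.OutEdges x :=
  LinearMap.pi fun e =>
    F.resTarget e.2 ∘ₗ LinearMap.proj (⟨e.1, lt_of_edge e.2⟩ : Set.Ioi x) ∘ₗ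
      (F.sections (Set.Ioi x)).subtype

/-- The module `F^{δx}`, the image of `u_x`. -/
def delta (F : Sheaf k G) (x : V) : Submodule (SymAlg k Y) (F.OutEdges x) :=
  LinearMap.range (F.sectionsToOutEdges x)

/-- A decomposition of a sheaf as an (internal) direct sum of two subsheaves, given by `A, A'`
on vertices and edges for the first one, and by `B, B'` for the second one. -/
structure IsDecomposition (F : Sheaf k G)
    (A : ∀ x, Submodule (SymAlg k Y) (F.stalk x))
    (A' : ∀ {x y} (h : G.Edge x y), Submodule (SymAlg k Y) (F.edgeStalk h))
    (B : ∀ x, Submodule (SymAlg k Y) (F.stalk x))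
    (B' : ∀ {x y} (h : G.Edge x y), Submodule (SymAlg k Y) (F.edgeStalk h)) : Prop where
  homogeneous_left : ∀ x, (F.stalk x).IsHomogeneous (A x)
  homogeneous_left' : ∀ {x y} (h : G.Edge x y), (F.edgeStalk h).IsHomogeneous (A' h)
  homogeneous_right : ∀ x, (F.stalk x).IsHomogeneous (B x)
  homogeneous_right' : ∀ {x y} (h : G.Edge x y), (F.edgeStalk h).IsHomogeneous (B' h)
  isCompl : ∀ x, IsCompl (A x) (B x)
  isCompl' : ∀ {x y} (h : G.Edge x y), IsCompl (A' h) (B' h)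
  source_left : ∀ {x y} (h : G.Edge x y), ∀ m ∈ A x, F.resSource h m ∈ A' h
  target_left : ∀ {x y} (h : G.Edge x y), ∀ m ∈ A y, F.resTarget h m ∈ A' h
  source_right : ∀ {x y} (h : G.Edge x y), ∀ m ∈ B x, F.resSource h m ∈ B' h
  target_right : ∀ {x y} (h : G.Edge x y), ∀ m ∈ B y, F.resTarget h m ∈ B' h

/-- A sheaf is indecomposable if it is nonzero, and in every decomposition of it as a direct sum
one of the two summands is zero. -/
structure IsIndecomposable (F : Sheaf k G) : Prop where
  nonzero : ¬ ((∀ x, Subsingleton (F.stalk x)) ∧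
    ∀ {x y} (h : G.Edge x y), Subsingleton (F.edgeStalk h))
  eq_zero : ∀ (A : ∀ x, Submodule (SymAlg k Y) (F.stalk x))
    (A' : ∀ {x y} (h : G.Edge x y), Submodule (SymAlg k Y) (F.edgeStalk h))
    (B : ∀ x, Submodule (SymAlg k Y) (F.stalk x))
    (B' : ∀ {x y} (h : G.Edge x y), Submodule (SymAlg k Y) (F.edgeStalk h)),
    F.IsDecomposition A A' B B' →
      ((∀ x, A x = ⊥) ∧ ∀ {x y} (h : G.Edge x y), A' h = ⊥) ∨
      ((∀ x, B x = ⊥) ∧ ∀ {x y} (h : G.Edge x y), B' h = ⊥)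

/-- `F` is a Braden-MacPherson (canonical) sheaf on the moment graph `G` with highest vertex
`w`. -/
structure IsBradenMacPherson (F : Sheaf k G) (w : V) : Prop where
  indecomposable : F.IsIndecomposable
  top_stalk : (F.stalk w).IsomorphicToSym
  resTarget_surjective : ∀ {x y} (h : G.Edge x y), Function.Surjective (F.resTarget h)
  resTarget_ker : ∀ {x y} (h : G.Edge x y) (m : F.stalk y),
    F.resTarget h m = 0 ↔ ∃ m' : F.stalk y, m = latticeToSym k Y (G.label h) • m'
  projectiveCover : ∀ {x y}, G.Edge x y →
    (F.stalk x).IsProjectiveCover (F.toOutEdges x) (F.delta x)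

end Sheaf

/-! ### Weyl groups of symmetrisable Kac-Moody algebras -/

/-- A symmetrisable generalised Cartan matrix of size `n`. -/
structure CartanMat (n : ℕ) where
  A : Matrix (Fin n) (Fin n) ℤ
  diag : ∀ i, A i i = 2
  offDiag : ∀ i j, i ≠ j → A i j ≤ 0
  zero_iff : ∀ i j, A i j = 0 ↔ A j i = 0
  symmetrisable : ∃ d : Fin n → ℂ, (∀ i, d i ≠ 0) ∧ ∀ i j, d i * (A i j : ℂ) = d j * (A j i : ℂ)

/-- A realisation `(𝔥, Π, Π^∨)` of a generalised Cartan matrix: the Cartan subalgebra of the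
associated Kac-Moody algebra, its simple roots and its simple coroots.
The pairing of the simple root `α_j` with the simple coroot `α_i^∨` is `A i j`. -/
structure Realisation {n : ℕ} (C : CartanMat n) (𝔥 : Type v) [AddCommGroup 𝔥] [Module ℂ 𝔥] where
  finiteDimensional : FiniteDimensional ℂ 𝔥
  root : Fin n → Module.Dual ℂ 𝔥
  coroot : Fin n → 𝔥
  root_independent : LinearIndependent ℂ root
  coroot_independent : LinearIndependent ℂ coroot
  pairing : ∀ i j, root j (coroot i) = (C.A i j : ℂ)
  finrank : Module.finrank ℂ 𝔥 + (C.A.map (Int.cast : ℤ → ℂ)).rank = 2 * n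

namespace Realisation

variable {n : ℕ} {C : CartanMat n} {𝔥 : Type v} [AddCommGroup 𝔥] [Module ℂ 𝔥]
  (R : Realisation C 𝔥)

theorem root_coroot_self (i : Fin n) : R.root i (R.coroot i) = 2 := by
  rw [R.pairing, C.diag]; norm_num

/-- The coroot lattice `Q^∨ = ∑ ℤ α_i^∨`. -/
def corootLattice : Submodule ℤ 𝔥 := Submodule.span ℤ (Set.range R.coroot)

/-- The simple reflection `λ ↦ λ - ⟨α_i, λ⟩ α_i^∨` of `𝔥`. -/
def simpleReflection (i : Fin n) : 𝔥 ≃ₗ[ℂ] 𝔥 := Module.reflection (R.root_coroot_self i)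

/-- The Weyl group, seen as the group of automorphisms of `𝔥` generated by the simple
reflections. -/
def weylGroup : Subgroup (𝔥 ≃ₗ[ℂ] 𝔥) := Subgroup.closure (Set.range R.simpleReflection)

/-- The Weyl group as a type. -/
def Weyl : Type v := R.weylGroup

instance : Group R.Weyl := inferInstanceAs (Group R.weylGroup)

/-- The linear automorphism of `𝔥` given by an element of the Weyl group. -/
def toGL : R.Weyl →* (𝔥 ≃ₗ[ℂ] 𝔥) := R.weylGroup.subtype

/-- The simple reflection `s_i` as an element of the Weyl group. -/
def simple (i : Fin n) : R.Weyl :=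
  (⟨R.simpleReflection i, Subgroup.subset_closure ⟨i, rfl⟩⟩ : R.weylGroup)

/-- The real root `u α_i`, where `u` acts on the dual of `𝔥` contragrediently. -/
def realRoot (u : R.Weyl) (i : Fin n) : Module.Dual ℂ 𝔥 :=
  R.root i ∘ₗ (R.toGL u⁻¹).toLinearMap

/-- The real coroot `u α_i^∨`, which is the coroot of the real root `u α_i`. -/
def realCoroot (u : R.Weyl) (i : Fin n) : 𝔥 := R.toGL u (R.coroot i)

/-- The reflection `u s_i u⁻¹`, which is the reflection `s_α` in the real root `α = u α_i`. -/
def refl (u : R.Weyl) (i : Fin n) : R.Weyl := u * R.simple i * u⁻¹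

theorem refl_apply (u : R.Weyl) (i : Fin n) (x : 𝔥) :
    R.toGL (R.refl u i) x = x - R.realRoot u i x • R.realCoroot u i := by
  have h : R.toGL (R.simple i) = R.simpleReflection i := rfl
  have h2 : R.toGL u (R.toGL u⁻¹ x) = x := by
    rw [← LinearEquiv.mul_apply, ← map_mul]; simp
  simp only [refl, map_mul, LinearEquiv.mul_apply, h, simpleReflection, Module.reflection_apply,
    map_sub, map_smul, h2, realRoot, realCoroot, LinearMap.comp_apply, LinearEquiv.coe_coe]

/-- A root is positive if it is a combination of simple roots with coefficients in `ℕ`. -/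
def IsPositive (α : Module.Dual ℂ 𝔥) : Prop := ∃ c : Fin n → ℕ, α = ∑ j, c j • R.root j

/-- The length function: the least length of a word in the simple reflections. -/
def length (w : R.Weyl) : ℕ :=
  sInf {m | ∃ l : List (Fin n), l.length = m ∧ (l.map R.simple).prod = w}

/-- One step `x → t x`, with `t` a reflection and `x` shorter than `t x`. -/
def BruhatStep (x y : R.Weyl) : Prop :=
  (∃ u i, y = R.refl u i * x) ∧ R.length x < R.length y

theorem length_le_of_reflTransGen {x y : R.Weyl}
    (h : Relation.ReflTransGen R.BruhatStep x y) : x = y ∨ R.length x < R.length y := by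
  induction h with
  | refl => exact Or.inl rfl
  | tail _ h ih =>
    rcases ih with rfl | ih
    · exact Or.inr h.2
    · exact Or.inr (ih.trans h.2)

/-- The Bruhat order on the Weyl group. -/
instance : PartialOrder R.Weyl where
  le := Relation.ReflTransGen R.BruhatStep
  le_refl _ := .refl
  le_trans _ _ _ := .trans
  le_antisymm x y hxy hyx := by
    rcases R.length_le_of_reflTransGen hxy with h | h
    · exact h
    · rcases R.length_le_of_reflTransGen hyx with h' | h'
      · exact h'.symm
      · exact absurd h' h.asymm

theorem toGL_mem_corootLattice (u : R.Weyl) {x : 𝔥} (hx : x ∈ R.corootLattice) :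
    R.toGL u x ∈ R.corootLattice := by
  have key : ∀ (i : Fin n) (x : 𝔥), x ∈ R.corootLattice →
      R.simpleReflection i x ∈ R.corootLattice := by
    intro i x hx
    induction hx using Submodule.span_induction with
    | mem x h =>
      obtain ⟨j, rfl⟩ := h
      rw [simpleReflection, Module.reflection_apply, R.pairing, Int.cast_smul_eq_zsmul]
      exact sub_mem (Submodule.subset_span ⟨j, rfl⟩)
        (Submodule.smul_mem _ _ (Submodule.subset_span ⟨i, rfl⟩))
    | zero => simp
    | add x y _ _ hx hy => rw [map_add]; exact add_mem hx hy
    | smul a x _ hx => rw [map_zsmul]; exact Submodule.smul_mem _ _ hx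
  obtain ⟨g, hg⟩ := u
  change g x ∈ R.corootLattice
  have inv_eq : ∀ i, (R.simpleReflection i)⁻¹ = R.simpleReflection i := fun i => by
    rw [inv_eq_iff_mul_eq_one]
    ext x
    exact Module.involutive_reflection (R.root_coroot_self i) x
  revert x
  refine Subgroup.closure_induction'' (p := fun g _ => ∀ {x : 𝔥}, x ∈ R.corootLattice →
    g x ∈ R.corootLattice) ?_ ?_ ?_ ?_ hg
  · rintro _ ⟨i, rfl⟩ x hx
    exact key i x hx
  · rintro _ ⟨i, rfl⟩ x hx
    rw [inv_eq]
    exact key i x hx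
  · exact fun hx => hx
  · intro a b _ _ ha hb x hx
    exact ha (hb hx)

theorem realCoroot_mem (u : R.Weyl) (i : Fin n) : R.realCoroot u i ∈ R.corootLattice :=
  R.toGL_mem_corootLattice u (Submodule.subset_span ⟨i, rfl⟩)

theorem realCoroot_ne_zero (u : R.Weyl) (i : Fin n) : R.realCoroot u i ≠ 0 := by
  intro h
  have h1 : R.coroot i = 0 := (R.toGL u).map_eq_zero_iff.1 h
  have h2 := R.root_coroot_self i
  rw [h1, map_zero] at h2
  norm_num at h2

/-- There is an edge `x → y` of the Bruhat graph if `x < y` and `y x⁻¹ = s_α` for a positive real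
root `α`. -/
def BruhatEdge (x y : R.Weyl) : Prop :=
  x < y ∧ ∃ p : R.Weyl × Fin n, R.IsPositive (R.realRoot p.1 p.2) ∧ y * x⁻¹ = R.refl p.1 p.2

/-- The Bruhat moment graph of the Weyl group, a moment graph on the coroot lattice.  The label of
an edge `x → s_α x`, with `α` a positive real root, is the coroot of `α` (which is determined
by `s_α`, so that the label does not depend on the choice made). -/
def bruhatGraph : MomentGraph R.corootLattice R.Weyl where
  Edge := R.BruhatEdge
  acyclic x h := by
    have : ∀ a b : R.Weyl, Relation.TransGen R.BruhatEdge a b → a < b := by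
      intro a b h
      induction h with
      | single h => exact h.1
      | tail _ h ih => exact ih.trans h.1
    exact lt_irrefl x (this x x h)
  le_of_edge h := h.1.le
  label h := ⟨R.realCoroot h.2.choose.1 h.2.choose.2, R.realCoroot_mem _ _⟩
  label_ne_zero h e := R.realCoroot_ne_zero _ _ (congrArg Subtype.val e)

/-- The moment graph `G_w`, the full subgraph of the Bruhat graph on `{x | x ≤ w}`. -/
def bruhatGraphLE (w : R.Weyl) : MomentGraph R.corootLattice (Set.Iic w) :=
  R.bruhatGraph.restrict (Set.Iic w)

end Realisation

end

end MomentSheaf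

/-!
The stalks of a Braden-MacPherson sheaf are determined from the top down: the stalk at `w` is `S_k`,
and the stalk at any other vertex `x` is a projective cover of a module built from the stalks
above `x`. So an isomorphism between an upper set of one moment graph and an upper set of another
(`MomentGraph.UpperIso`) induces isomorphisms of the stalks (`Sheaf.exists_semiIso_stalk`). Such an
isomorphism of graphs is allowed to change the labels by an automorphism of the lattice at each
vertex, with the automorphisms at the ends of an edge congruent modulo the label; the isomorphisms
of stalks are then semilinear over the induced automorphisms of `S_k`. The inductive step is the
uniqueness of projective covers, in the form `GradedMod.IsSemiRel.exists_semiIso`: it is stated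
for a relation between two projective modules, so that the modules of the edges need not be
identified with each other.

The isomorphism of graphs in (i) is inversion, with the automorphism `x⁻¹` at the vertex `x`. It
gives an isomorphism of stalks that is semilinear over `y⁻¹`. The twist is undone by
`GradedMod.IsProjective.exists_semiIso_self`: a projective graded module is isomorphic to its
twists, because automorphisms of the lattice act trivially on `S_k` modulo its augmentation ideal,
and the graded Nakayama lemma makes the module a projective cover of its reduction modulo that
ideal. In (ii), `z ↦ z s` maps `[y, w]` isomorphically onto `[y s, w s]` and preserves the labels.

Both graph isomorphisms need that every real root is positive or negative (`isPositive_or_neg`), the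
Bruhat graph having edges for positive real roots only. This is proved as for Coxeter groups, by
reduction to rank two, where it follows from an invariant quadratic form. It yields the exchange
property, the criterion for `ℓ(x s_β) > ℓ(x)` in terms of the sign of `x β`, and the lifting
properties of the Bruhat order (`le_mul_simple_or`, `mul_simple_le_or`).
-/

namespace MomentSheaf

noncomputable section

/-! ### Automorphisms of `S_k` induced by automorphisms of the lattice -/

section SymMap

variable {k : Type u} [CommRing k] {Y : Type v} [AddCommGroup Y]

/-- The endomorphism of `S_k` induced by an endomorphism of the lattice. -/
def symHom (g : Y →ₗ[ℤ] Y) : SymAlg k Y →ₐ[k] SymAlg k Y :=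
  SymmetricAlgebra.lift (SymmetricAlgebra.ι k (k ⊗[ℤ] Y) ∘ₗ g.baseChange k)

theorem symHom_ι (g : Y →ₗ[ℤ] Y) (x : k ⊗[ℤ] Y) :
    symHom g (SymmetricAlgebra.ι k _ x) = SymmetricAlgebra.ι k _ (g.baseChange k x) := by
  simp [symHom]

theorem symHom_comp_apply (g g' : Y →ₗ[ℤ] Y) (s : SymAlg k Y) :
    symHom g (symHom g' s) = symHom (g ∘ₗ g') s := by
  have : (symHom g).comp (symHom (k := k) g') = symHom (g ∘ₗ g') := by
    apply SymmetricAlgebra.algHom_ext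
    ext x
    simp [symHom_ι]
  exact congrArg (fun f => f s) this

theorem symHom_id_apply (s : SymAlg k Y) : symHom (LinearMap.id : Y →ₗ[ℤ] Y) s = s := by
  have : symHom (k := k) (LinearMap.id : Y →ₗ[ℤ] Y) = AlgHom.id k _ := by
    apply SymmetricAlgebra.algHom_ext
    ext x
    simp [symHom_ι]
  exact congrArg (fun f => f s) this

/-- The automorphism of `S_k` induced by an automorphism of the lattice. -/
def symMap (g : Y ≃ₗ[ℤ] Y) : SymAlg k Y ≃+* SymAlg k Y where
  __ := (symHom (g : Y →ₗ[ℤ] Y)).toRingHom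
  invFun := symHom (g.symm : Y →ₗ[ℤ] Y)
  left_inv s := by
    change symHom _ (symHom _ s) = s
    rw [symHom_comp_apply]
    simp [symHom_id_apply]
  right_inv s := by
    change symHom _ (symHom _ s) = s
    rw [symHom_comp_apply]
    simp [symHom_id_apply]

theorem symMap_symm (g : Y ≃ₗ[ℤ] Y) : (symMap (k := k) g).symm = symMap g.symm := rfl

theorem symMap_refl_apply (s : SymAlg k Y) : symMap (LinearEquiv.refl ℤ Y) s = s :=
  symHom_id_apply s

theorem symMap_algebraMap (g : Y ≃ₗ[ℤ] Y) (c : k) :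
    symMap g (algebraMap k (SymAlg k Y) c) = algebraMap k _ c :=
  (symHom (g : Y →ₗ[ℤ] Y)).commutes c

theorem symMap_ι (g : Y ≃ₗ[ℤ] Y) (x : k ⊗[ℤ] Y) :
    symMap g (SymmetricAlgebra.ι k _ x) =
      SymmetricAlgebra.ι k _ ((g : Y →ₗ[ℤ] Y).baseChange k x) :=
  symHom_ι _ x

theorem symMap_latticeToSym (g : Y ≃ₗ[ℤ] Y) (l : Y) :
    symMap g (latticeToSym k Y l) = latticeToSym k Y (g l) := by
  simp [latticeToSym, symMap_ι]

theorem latticeToSym_neg (l : Y) : latticeToSym k Y (-l) = -latticeToSym k Y l := by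
  simp [latticeToSym, TensorProduct.tmul_neg]

theorem latticeToSym_zsmul (c : ℤ) (l : Y) :
    latticeToSym k Y (c • l) = (c : SymAlg k Y) * latticeToSym k Y l := by
  rw [latticeToSym, TensorProduct.tmul_smul, map_zsmul, zsmul_eq_mul, latticeToSym]

theorem ι_mem_symDeg (x : k ⊗[ℤ] Y) : SymmetricAlgebra.ι k _ x ∈ symDeg k Y 2 := by
  refine Submodule.mem_iSup_of_mem 1 (Submodule.mem_iSup_of_mem (by norm_num) ?_)
  rw [pow_one]
  exact ⟨x, rfl⟩

theorem algebraMap_mem_symDeg (c : k) : algebraMap k (SymAlg k Y) c ∈ symDeg k Y 0 := by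
  refine Submodule.mem_iSup_of_mem 0 (Submodule.mem_iSup_of_mem (by norm_num) ?_)
  rw [pow_zero]
  exact Submodule.algebraMap_mem c

theorem symMap_mem_symDeg (g : Y ≃ₗ[ℤ] Y) {i : ℤ} {s : SymAlg k Y} (hs : s ∈ symDeg k Y i) :
    symMap g s ∈ symDeg k Y i := by
  have h : (symDeg k Y i).map (symHom (k := k) (g : Y →ₗ[ℤ] Y)).toLinearMap ≤ symDeg k Y i := by
    simp only [symDeg, Submodule.map_iSup]
    refine iSup₂_mono fun d _ => ?_
    rw [Submodule.map_pow]
    refine pow_le_pow_left' ?_ d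
    rintro _ ⟨_, ⟨x, rfl⟩, rfl⟩
    exact ⟨_, (symHom_ι _ x).symm⟩
  exact h ⟨s, hs, rfl⟩

theorem symMap_mem_symDeg_iff (g : Y ≃ₗ[ℤ] Y) {i : ℤ} {s : SymAlg k Y} :
    symMap g s ∈ symDeg k Y i ↔ s ∈ symDeg k Y i := by
  refine ⟨fun h => ?_, symMap_mem_symDeg g⟩
  have := symMap_mem_symDeg g.symm h
  rwa [← symMap_symm, RingEquiv.symm_apply_apply] at this

/-- Two automorphisms of the lattice which agree modulo `l` induce automorphisms of `S_k` which
agree modulo `l`. -/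
theorem latticeToSym_dvd_symMap_sub {g g' : Y ≃ₗ[ℤ] Y} {l : Y}
    (h : ∀ y, ∃ c : ℤ, g y - g' y = c • l) (s : SymAlg k Y) :
    latticeToSym k Y l ∣ symMap g s - symMap g' s := by
  induction s using SymmetricAlgebra.induction with
  | algebraMap r => simp [symMap_algebraMap]
  | ι x =>
    rw [symMap_ι, symMap_ι]
    induction x using TensorProduct.induction_on with
    | zero => simp
    | tmul a y =>
      obtain ⟨c, hc⟩ := h y
      refine ⟨algebraMap k _ a * (c : SymAlg k Y), ?_⟩
      rw [← map_sub, LinearMap.baseChange_tmul, LinearMap.baseChange_tmul,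
        ← TensorProduct.tmul_sub]
      simp only [LinearEquiv.coe_coe, hc]
      rw [← mul_one a, ← smul_eq_mul, ← TensorProduct.smul_tmul', map_smul, Algebra.smul_def]
      have := latticeToSym_zsmul (k := k) c l
      rw [latticeToSym] at this
      rw [this]
      simp
      ring
    | add x y hx hy =>
      have := dvd_add hx hy
      simp only [map_add]
      convert this using 1
      ring
  | mul a b ha hb =>
    have := dvd_add (ha.mul_right (symMap g b)) (hb.mul_left (symMap g' a))
    simp only [map_mul]
    convert this using 1
    ring
  | add a b ha hb =>
    have := dvd_add ha hb
    simp only [map_add]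
    convert this using 1
    ring

/-- The augmentation ideal of `S_k`, generated by `Y_k`. -/
def augIdeal (k : Type u) [CommRing k] (Y : Type v) [AddCommGroup Y] : Ideal (SymAlg k Y) :=
  Ideal.span (Set.range (SymmetricAlgebra.ι k (k ⊗[ℤ] Y)))

theorem sub_symMap_mem_augIdeal (g : Y ≃ₗ[ℤ] Y) (s : SymAlg k Y) :
    s - symMap g s ∈ augIdeal k Y := by
  induction s using SymmetricAlgebra.induction with
  | algebraMap r => simp [symMap_algebraMap]
  | ι x =>
    rw [symMap_ι, ← map_sub]
    exact Ideal.subset_span ⟨_, rfl⟩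
  | mul a b ha hb =>
    have := add_mem (Ideal.mul_mem_right b _ ha) (Ideal.mul_mem_left _ (symMap g a) hb)
    simp only [map_mul]
    convert this using 1
    ring
  | add a b ha hb =>
    have := add_mem ha hb
    simp only [map_add]
    convert this using 1
    ring

end SymMap

/-! ### Graded modules -/

namespace GradedMod

variable {k : Type u} [CommRing k] {Y : Type v} [AddCommGroup Y]

instance (M : GradedMod k Y) : DirectSum.Decomposition M.deg :=
  M.isInternal.chooseDecomposition

/-- The homogeneous component of degree `i` of an element. -/
def comp (M : GradedMod k Y) (i : ℤ) : M →+ M :=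
  (M.deg i).subtype.comp
    ((DFinsupp.evalAddMonoidHom i).comp (DirectSum.decomposeAddEquiv M.deg).toAddMonoidHom)

section comp

variable (M : GradedMod k Y)

theorem comp_apply (i : ℤ) (m : M) : M.comp i m = (DirectSum.decompose M.deg m i : M) := rfl

theorem comp_mem (i : ℤ) (m : M) : M.comp i m ∈ M.deg i := Subtype.property _

variable {M}

theorem comp_of_mem {i : ℤ} {m : M} (h : m ∈ M.deg i) : M.comp i m = m :=
  DirectSum.decompose_of_mem_same _ h

theorem comp_of_mem_ne {i j : ℤ} {m : M} (h : m ∈ M.deg i) (hij : i ≠ j) : M.comp j m = 0 :=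
  DirectSum.decompose_of_mem_ne _ h hij

theorem mem_deg_of_comp {i : ℤ} {m : M} (h : M.comp i m = m) : m ∈ M.deg i := h ▸ M.comp_mem i m

theorem sum_comp (m : M) : ∃ s : Finset ℤ, ∑ i ∈ s, M.comp i m = m := by
  classical
  exact ⟨_, DirectSum.sum_support_decompose M.deg m⟩

theorem homogeneous_induction {p : M → Prop} (zero : p 0)
    (homogeneous : ∀ i, ∀ m ∈ M.deg i, p m) (add : ∀ m m', p m → p m' → p (m + m')) (m : M) :
    p m :=
  DirectSum.Decomposition.inductionOn M.deg zero (fun m => homogeneous _ m m.2) add m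

theorem comp_smul {i : ℤ} {s : SymAlg k Y} (hs : s ∈ symDeg k Y i) (j : ℤ) (m : M) :
    M.comp j (s • m) = s • M.comp (j - i) m := by
  induction m using homogeneous_induction with
  | zero => simp
  | add m m' h h' => simp [h, h']
  | homogeneous d m hm =>
    have h := M.smul_mem hs hm
    by_cases hd : i + d = j
    · subst hd
      rw [comp_of_mem h, comp_of_mem (by simpa using hm)]
    · rw [comp_of_mem_ne h hd, comp_of_mem_ne hm (by omega), smul_zero]

theorem map_comp {N : GradedMod k Y} (f : M →+ N) (hf : ∀ i, ∀ m ∈ M.deg i, f m ∈ N.deg i)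
    (i : ℤ) (m : M) : f (M.comp i m) = N.comp i (f m) := by
  induction m using homogeneous_induction with
  | zero => simp
  | add m m' h h' => simp [h, h']
  | homogeneous d m hm =>
    by_cases hd : d = i
    · subst hd
      rw [comp_of_mem hm, comp_of_mem (hf _ _ hm)]
    · rw [comp_of_mem_ne hm hd, comp_of_mem_ne (hf _ _ hm) hd, map_zero]

/-- A set of elements closed under the action of `k` and of `Y_k` is closed under `S_k`. -/
theorem smul_mem_of_generators {A : AddSubgroup M}
    (hk : ∀ (c : k), ∀ m ∈ A, algebraMap k (SymAlg k Y) c • m ∈ A)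
    (hY : ∀ (x : k ⊗[ℤ] Y), ∀ m ∈ A, SymmetricAlgebra.ι k _ x • m ∈ A)
    (s : SymAlg k Y) : ∀ m ∈ A, s • m ∈ A := by
  induction s using SymmetricAlgebra.induction with
  | algebraMap r => exact hk r
  | ι x => exact hY x
  | mul a b ha hb => exact fun m hm => by rw [mul_smul]; exact ha _ (hb _ hm)
  | add a b ha hb => exact fun m hm => by rw [add_smul]; exact add_mem (ha _ hm) (hb _ hm)

theorem isHomogeneous_iff {N : Submodule (SymAlg k Y) M} :
    M.IsHomogeneous N ↔ ∀ i, ∀ m ∈ N, M.comp i m ∈ N := by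
  constructor
  · intro h i m hm
    let A : AddSubgroup M := ⨅ j, N.toAddSubgroup.comap (M.comp j)
    have hA : ∀ m, m ∈ A ↔ ∀ j, M.comp j m ∈ N := fun m => by simp [A]
    let N' : Submodule (SymAlg k Y) M :=
      { A with
        smul_mem' := fun s m hm => by
          refine smul_mem_of_generators (A := A) (fun c m hm => ?_) (fun x m hm => ?_) s m hm
          · rw [hA] at hm ⊢
            exact fun j => by
              rw [comp_smul (algebraMap_mem_symDeg c)]; exact N.smul_mem _ (hm _)
          · rw [hA] at hm ⊢
            exact fun j => by rw [comp_smul (ι_mem_symDeg x)]; exact N.smul_mem _ (hm _) }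
    have hN : N ≤ N' := by
      rw [← h, Submodule.span_le]
      rintro m ⟨hm, d, hd⟩
      refine (hA m).2 fun j => ?_
      by_cases hj : d = j
      · subst hj; rwa [comp_of_mem hd]
      · rw [comp_of_mem_ne hd hj]; exact zero_mem _
    exact (hA m).1 (hN hm) i
  · intro h
    refine le_antisymm (Submodule.span_le.2 fun m hm => hm.1) fun m hm => ?_
    obtain ⟨s, hs⟩ := sum_comp m
    rw [← hs]
    exact sum_mem fun i _ => Submodule.subset_span ⟨h i m hm, i, M.comp_mem i m⟩

theorem isHomogeneous_range {N : GradedMod k Y} {f : M →ₗ[SymAlg k Y] N} (hf : IsDegZero f) :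
    N.IsHomogeneous (LinearMap.range f) := by
  rw [isHomogeneous_iff]
  rintro i _ ⟨m, rfl⟩
  exact ⟨M.comp i m, map_comp f.toAddMonoidHom hf i m⟩

end comp

/-! ### Quotients and twists of graded modules -/

/-- The quotient of a graded module by a homogeneous submodule. -/
def quot (M : GradedMod k Y) (K : Submodule (SymAlg k Y) M) (hK : ∀ i, ∀ m ∈ K, M.comp i m ∈ K) :
    GradedMod k Y where
  carrier := M ⧸ K
  deg i := (M.deg i).map K.mkQ.toAddMonoidHom
  isInternal := by
    let q (i : ℤ) : M.deg i →+ (M.deg i).map K.mkQ.toAddMonoidHom :=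
      (K.mkQ.toAddMonoidHom).addSubgroupMap (M.deg i)
    let f : M →+ DirectSum ℤ fun i => (M.deg i).map K.mkQ.toAddMonoidHom :=
      (DirectSum.map q).comp (DirectSum.decomposeAddEquiv M.deg).toAddMonoidHom
    have hf : ∀ m i, (f m i : M ⧸ K) = K.mkQ (M.comp i m) := fun m i => by
      simp [f, q, DirectSum.map_apply, comp_apply]
    have hf0 : K.toAddSubgroup ≤ f.ker := by
      intro m hm
      rw [AddMonoidHom.mem_ker]
      refine DFinsupp.ext fun i => Subtype.ext ?_
      rw [hf]
      simpa using hK i m hm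
    let d : M ⧸ K →+ DirectSum ℤ fun i => (M.deg i).map K.mkQ.toAddMonoidHom :=
      QuotientAddGroup.lift K.toAddSubgroup f hf0
    have hd : ∀ m, d (K.mkQ m) = f m := fun m => rfl
    let _ := DirectSum.Decomposition.ofAddHom
      (fun i => (M.deg i).map K.mkQ.toAddMonoidHom) d ?_ ?_
    · exact DirectSum.Decomposition.isInternal _
    · ext x
      obtain ⟨m, rfl⟩ := K.mkQ_surjective x
      rw [AddMonoidHom.comp_apply, hd]
      induction m using homogeneous_induction with
      | zero => simp
      | add m m' h h' => rw [map_add, map_add, h, h']; rfl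
      | homogeneous i m hm =>
        simp only [f, AddMonoidHom.comp_apply]
        erw [DirectSum.decompose_of_mem _ hm, DirectSum.map_of, DirectSum.coeAddMonoidHom_of]
        rfl
    · ext i ⟨_, m, hm, rfl⟩ : 2
      simp only [AddMonoidHom.comp_apply, DirectSum.coeAddMonoidHom_of, AddMonoidHom.id_apply]
      change f m = _
      simp only [f, AddMonoidHom.comp_apply]
      erw [DirectSum.decompose_of_mem _ hm, DirectSum.map_of]
      rfl
  smul_mem := by
    rintro i j s _ hs ⟨m, hm, rfl⟩
    exact ⟨s • m, M.smul_mem hs hm, map_smul K.mkQ s m⟩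

theorem isDegZero_mkQ (M : GradedMod k Y) (K : Submodule (SymAlg k Y) M)
    (hK : ∀ i, ∀ m ∈ K, M.comp i m ∈ K) : IsDegZero (N := M.quot K hK) K.mkQ :=
  fun _ m hm => ⟨m, hm, rfl⟩

/-- The carrier of the twist of a graded module by an automorphism `g` of the lattice: `s ∈ S_k`
acts on it as `g s` acts on the module. -/
def Twist (M : GradedMod k Y) (_ : Y ≃ₗ[ℤ] Y) : Type (max u v) := M.carrier

instance (M : GradedMod k Y) (g : Y ≃ₗ[ℤ] Y) : AddCommGroup (M.Twist g) := M.addCommGroup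

/-- The identity map, from a module to its twist. -/
def toTwist (M : GradedMod k Y) (g : Y ≃ₗ[ℤ] Y) : M ≃+ M.Twist g := AddEquiv.refl M.carrier

instance (M : GradedMod k Y) (g : Y ≃ₗ[ℤ] Y) : Module (SymAlg k Y) (M.Twist g) :=
  Module.compHom M.carrier (symMap (k := k) g : SymAlg k Y →+* SymAlg k Y)

theorem toTwist_smul (M : GradedMod k Y) (g : Y ≃ₗ[ℤ] Y) (s : SymAlg k Y) (m : M) :
    M.toTwist g (symMap g s • m) = s • M.toTwist g m := rfl

/-- The twist of a graded module by an automorphism of the lattice. -/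
def twist (M : GradedMod k Y) (g : Y ≃ₗ[ℤ] Y) : GradedMod k Y where
  carrier := M.Twist g
  finite := by
    let _ : RingHomSurjective (symMap (k := k) g.symm : SymAlg k Y →+* SymAlg k Y) :=
      ⟨(symMap (k := k) g.symm).surjective⟩
    let f : M →ₛₗ[(symMap (k := k) g.symm : SymAlg k Y →+* SymAlg k Y)] M.Twist g :=
      { (M.toTwist g : M →+ M.Twist g) with
        map_smul' := fun s m => by
          change M.toTwist g (s • m) = symMap g.symm s • M.toTwist g m
          rw [← toTwist_smul, ← symMap_symm, RingEquiv.apply_symm_apply] }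
    exact Module.Finite.of_surjective f (M.toTwist g).surjective
  deg i := (M.deg i).map (M.toTwist g : M →+ M.Twist g)
  isInternal := by
    have : (fun i => (M.deg i).map (M.toTwist g : M →+ M.Twist g)) = M.deg :=
      funext fun i => AddSubgroup.map_id _
    rw [this]
    exact M.isInternal
  smul_mem := by
    rintro i j s _ hs ⟨m, hm, rfl⟩
    exact ⟨symMap g s • m, M.smul_mem (symMap_mem_symDeg g hs) hm, rfl⟩

theorem toTwist_mem_deg (M : GradedMod k Y) (g : Y ≃ₗ[ℤ] Y) {i : ℤ} {m : M} :
    M.toTwist g m ∈ (M.twist g).deg i ↔ m ∈ M.deg i :=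
  ⟨fun ⟨_, h, e⟩ => (M.toTwist g).injective e ▸ h, fun h => ⟨m, h, rfl⟩⟩

theorem comp_toTwist (M : GradedMod k Y) (g : Y ≃ₗ[ℤ] Y) (i : ℤ) (m : M) :
    (M.twist g).comp i (M.toTwist g m) = M.toTwist g (M.comp i m) :=
  (map_comp (N := M.twist g) (M.toTwist g : M →+ M.Twist g)
    (fun _ _ h => (M.toTwist_mem_deg g).2 h) i m).symm

end GradedMod

namespace GradedMod
variable {k : Type u} [CommRing k] {Y : Type v} [AddCommGroup Y]

/-! ### Uniqueness of projective covers, up to a twist -/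

/-- An additive bijection between graded modules that is semilinear over the automorphism of `S_k`
given by `g` and identifies the homogeneous components. -/
structure IsSemiIso {M N : GradedMod k Y} (g : Y ≃ₗ[ℤ] Y) (φ : M ≃+ N) : Prop where
  map_smul : ∀ (s : SymAlg k Y) (m : M), φ (s • m) = symMap g s • φ m
  mem_deg : ∀ (i : ℤ) (m : M), φ m ∈ N.deg i ↔ m ∈ M.deg i

/-- A homogeneous additive relation between graded modules that is semilinear over the automorphism
of `S_k` given by `g`. -/
structure IsSemiRel {M N : GradedMod k Y} (g : Y ≃ₗ[ℤ] Y) (r : M → N → Prop) : Prop where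
  add : ∀ {m m' n n'}, r m n → r m' n' → r (m + m') (n + n')
  smul : ∀ (s : SymAlg k Y) {m n}, r m n → r (s • m) (symMap g s • n)
  comp : ∀ (i : ℤ) {m n}, r m n → r (M.comp i m) (N.comp i n)

/-- The map `φ` is semilinear over the automorphism given by `g`, of degree zero, and its graph is
contained in the relation `r`. -/
structure IsSemiSection {M N : GradedMod k Y} (g : Y ≃ₗ[ℤ] Y) (r : M → N → Prop) (φ : M →+ N) :
    Prop where
  map_smul : ∀ (s : SymAlg k Y) (m : M), φ (s • m) = symMap g s • φ m
  mem_deg : ∀ (i : ℤ) (m : M), m ∈ M.deg i → φ m ∈ N.deg i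
  rel : ∀ m, r m (φ m)

/-- The only homogeneous submodule `N` of `M` with `N + K = M` is `M` itself. -/
def IsSuperfluous (M : GradedMod k Y) (K : Set M) : Prop :=
  ∀ N : Submodule (SymAlg k Y) M, M.IsHomogeneous N → (∀ m, ∃ x ∈ K, m - x ∈ N) → N = ⊤

theorem IsSuperfluous.mono {M : GradedMod k Y} {K K' : Set M} (h : M.IsSuperfluous K)
    (hK : K' ⊆ K) : M.IsSuperfluous K' :=
  fun N hN hm => h N hN fun m => (hm m).imp fun _ hx => ⟨hK hx.1, hx.2⟩

variable {M N : GradedMod k Y} {g : Y ≃ₗ[ℤ] Y} {r : M → N → Prop}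

theorem IsSemiIso.comp_apply {φ : M ≃+ N} (h : IsSemiIso g φ) (i : ℤ) (m : M) :
    φ (M.comp i m) = N.comp i (φ m) :=
  map_comp φ.toAddMonoidHom (fun _ _ => (h.mem_deg _ _).2) i m

namespace IsSemiRel

theorem flip (hr : IsSemiRel g r) : IsSemiRel g.symm (fun n m => r m n) where
  add h h' := hr.add h h'
  smul s m n h := by
    have := hr.smul (symMap g.symm s) h
    rwa [← symMap_symm, RingEquiv.apply_symm_apply] at this
  comp i _ _ h := hr.comp i h

theorem sub (hr : IsSemiRel g r) {m m' : M} {n n' : N} (h : r m n) (h' : r m' n') :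
    r (m - m') (n - n') := by
  have := hr.add h (hr.smul (-1) h')
  simpa [sub_eq_add_neg] using this

theorem zero (hr : IsSemiRel g r) {m : M} {n : N} (h : r m n) : r 0 0 := by
  simpa using hr.sub h h

/-- A total semilinear relation out of a projective module contains the graph of a map. -/
theorem exists_section (hr : IsSemiRel g r) (hM : M.IsProjective) (htot : ∀ m, ∃ n, r m n) :
    ∃ φ : M →+ N, IsSemiSection g r φ := by
  have h0 : r 0 0 := hr.zero (htot 0).choose_spec
  let K : Submodule (SymAlg k Y) (N.twist g) :=
    { carrier := {n | r 0 ((N.toTwist g).symm n)}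
      add_mem' := fun {a b} ha hb => by
        have := hr.add ha hb
        rw [add_zero] at this
        exact this
      zero_mem' := h0
      smul_mem' := fun s n hn => by
        have := hr.smul s hn
        rw [smul_zero] at this
        exact this }
  have hmem : ∀ n : N, (N.toTwist g n : N.twist g) ∈ K ↔ r 0 n := fun n => Iff.rfl
  have hK : ∀ i, ∀ n ∈ K, (N.twist g).comp i n ∈ K := by
    intro i n hn
    obtain ⟨n, rfl⟩ := (N.toTwist g).surjective n
    rw [comp_toTwist]
    have := hr.comp i ((hmem n).1 hn)
    rw [map_zero] at this
    exact (hmem _).2 this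
  let Q := (N.twist g).quot K hK
  let q : N.twist g →ₗ[SymAlg k Y] Q := K.mkQ
  have hq : ∀ {m : M} {n n' : N}, r m n → r m n' → q (N.toTwist g n) = q (N.toTwist g n') := by
    intro m n n' h h'
    refine (Submodule.Quotient.eq K).2 ?_
    have := hr.sub h h'
    rw [sub_self] at this
    exact (hmem _).2 this
  choose f hf using htot
  let F : M →ₗ[SymAlg k Y] Q :=
    { toFun := fun m => q (N.toTwist g (f m))
      map_add' := fun m m' => by
        rw [hq (hf (m + m')) (hr.add (hf m) (hf m')), map_add]
        exact map_add q _ _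
      map_smul' := fun s m => by
        rw [hq (hf (s • m)) (hr.smul s (hf m)), toTwist_smul]
        exact map_smul q _ _ }
  have hF : IsDegZero F := by
    intro i m hm
    have h1 := hr.comp i (hf m)
    rw [comp_of_mem hm] at h1
    change q (N.toTwist g (f m)) ∈ _
    rw [hq (hf m) h1]
    exact isDegZero_mkQ _ K hK i _ ((N.toTwist_mem_deg g).2 (N.comp_mem i _))
  obtain ⟨φ, hφ, hφ'⟩ := hM (N.twist g) Q q F (isDegZero_mkQ _ K hK) K.mkQ_surjective hF
  refine ⟨(N.toTwist g).symm.toAddMonoidHom.comp φ.toAddMonoidHom, fun s m => ?_, fun i m hm => ?_,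
    fun m => ?_⟩
  · change (N.toTwist g).symm (φ (s • m)) = _
    rw [map_smul]
    rfl
  · exact (N.toTwist_mem_deg g).1 (hφ i m hm)
  · change r m ((N.toTwist g).symm (φ m))
    have h1 : q (φ m) = q (N.toTwist g (f m)) := congrArg (fun h => h m) hφ'
    have h2 := (hmem ((N.toTwist g).symm (φ m) - f m)).1 ((Submodule.Quotient.eq K).1 h1)
    simpa using hr.add h2 (hf m)

/-- If `m` is related to zero only for `m` in a superfluous subset, then maps back and forth with
graphs in the relation have a bijective composite. -/
theorem bijective_of_sections (hr : IsSemiRel g r) (hs : M.IsSuperfluous {m | r m 0})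
    {φ : M →+ N} (hφ : IsSemiSection g r φ) {ψ : N →+ M}
    (hψ : IsSemiSection g.symm (fun n m => r m n) ψ) : Function.Bijective fun m => ψ (φ m) := by
  let f : M →ₗ[SymAlg k Y] M :=
    { ψ.comp φ with
      map_smul' := fun s m => by
        change ψ (φ (s • m)) = s • ψ (φ m)
        rw [hφ.map_smul, hψ.map_smul, ← symMap_symm, RingEquiv.symm_apply_apply] }
  have hf : IsDegZero f := fun i m hm => hψ.mem_deg _ _ (hφ.mem_deg _ _ hm)
  have htop := hs _ (isHomogeneous_range hf) fun m => ⟨m - f m, by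
    have := hr.sub (hφ.rel m) (hψ.rel (φ m))
    rwa [sub_self] at this, m, by simp⟩
  have hsurj : Function.Surjective f := LinearMap.range_eq_top.1 htop
  exact ⟨OrzechProperty.injective_of_surjective_endomorphism f hsurj, hsurj⟩

/-- Uniqueness of projective covers: a semilinear relation between projective modules that is total
on both sides and is an isomorphism modulo superfluous submodules contains the graph of an
isomorphism. -/
theorem exists_semiIso (hr : IsSemiRel g r) (hM : M.IsProjective) (hN : N.IsProjective)
    (hl : ∀ m, ∃ n, r m n) (hr' : ∀ n, ∃ m, r m n)
    (hsM : M.IsSuperfluous {m | r m 0}) (hsN : N.IsSuperfluous {n | r 0 n}) :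
    ∃ φ : M ≃+ N, IsSemiIso g φ ∧ ∀ m, r m (φ m) := by
  obtain ⟨φ, hφ⟩ := hr.exists_section hM hl
  obtain ⟨ψ, hψ⟩ := hr.flip.exists_section hN hr'
  have hinj := (hr.bijective_of_sections hsM hφ hψ).1
  have hsurj := (hr.flip.bijective_of_sections hsN hψ hφ).2
  have hb : Function.Bijective φ :=
    ⟨Function.Injective.of_comp (f := ψ) hinj, Function.Surjective.of_comp (g := ψ) hsurj⟩
  refine ⟨AddEquiv.ofBijective φ hb,
    ⟨hφ.map_smul, fun i m => ⟨fun h => ?_, hφ.mem_deg i m⟩⟩, hφ.rel⟩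
  have h' : φ m ∈ N.deg i := h
  refine mem_deg_of_comp (hb.1 ?_)
  rw [map_comp φ hφ.mem_deg, comp_of_mem h']

end IsSemiRel

/-! ### The graded Nakayama lemma and twists of projective modules -/

theorem exists_deg_bound (M : GradedMod k Y) : ∃ d : ℤ, ∀ i < d, ∀ m, M.comp i m = 0 := by
  obtain ⟨S, hS⟩ := (Module.finite_def.1 M.finite)
  choose t ht using fun m : M => sum_comp m
  have hlow : ∀ m : M, ∃ d : ℤ, ∀ i < d, M.comp i m = 0 := by
    intro m
    obtain ⟨d, hd⟩ := (t m).bddBelow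
    refine ⟨d, fun i hi => ?_⟩
    rw [← ht m, map_sum]
    refine Finset.sum_eq_zero fun j hj => comp_of_mem_ne (M.comp_mem j m) ?_
    have := hd (Finset.mem_coe.2 hj)
    omega
  choose b hb using hlow
  obtain ⟨d, hd⟩ := (S.image b).bddBelow
  refine ⟨d, fun i hi m => ?_⟩
  let A : AddSubgroup M := ⨅ j : Set.Iio d, (M.comp j).ker
  have hA : ∀ m, m ∈ A ↔ ∀ j < d, M.comp j m = 0 := fun m => by simp [A]
  have hm : m ∈ Submodule.span (SymAlg k Y) (S : Set M) := hS ▸ Submodule.mem_top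
  suffices m ∈ A from (hA m).1 this i hi
  induction hm using Submodule.span_induction with
  | mem x hx =>
    refine (hA x).2 fun j hj => hb x j (hj.trans_le (hd ?_))
    exact Finset.mem_coe.2 (Finset.mem_image_of_mem b hx)
  | zero => exact zero_mem _
  | add x y _ _ hx hy => exact add_mem hx hy
  | smul s x _ hx =>
    refine smul_mem_of_generators (fun c m hm => ?_) (fun y m hm => ?_) s x hx
    · rw [hA] at hm ⊢
      intro j hj
      rw [comp_smul (algebraMap_mem_symDeg c), hm _ (by omega), smul_zero]
    · rw [hA] at hm ⊢
      intro j hj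
      rw [comp_smul (ι_mem_symDeg y), hm _ (by omega), smul_zero]

theorem augIdeal_smul_induction {M : GradedMod k Y} {p : M → Prop}
    (ι : ∀ (x : k ⊗[ℤ] Y) (m : M), p (SymmetricAlgebra.ι k _ x • m)) (zero : p 0)
    (add : ∀ m m', p m → p m' → p (m + m')) {m : M}
    (hm : m ∈ augIdeal k Y • (⊤ : Submodule (SymAlg k Y) M)) : p m := by
  refine Submodule.smul_induction_on hm (fun r hr n _ => ?_) add
  induction hr using Submodule.span_induction generalizing n with
  | mem x hx =>
    obtain ⟨x, rfl⟩ := hx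
    exact ι x n
  | zero => rwa [zero_smul]
  | add a b _ _ ha hb =>
    rw [add_smul]
    exact add _ _ (ha n trivial) (hb n trivial)
  | smul a b _ hb =>
    rw [smul_eq_mul, mul_comm, mul_smul]
    exact hb _ trivial

/-- The graded Nakayama lemma. It holds over any base ring, since finitely generated graded modules
are bounded below. -/
theorem isSuperfluous_augIdeal_smul (M : GradedMod k Y) :
    M.IsSuperfluous (augIdeal k Y • (⊤ : Submodule (SymAlg k Y) M) : Submodule (SymAlg k Y) M) := by
  intro N hN hcov
  rw [isHomogeneous_iff] at hN
  obtain ⟨d, hd⟩ := M.exists_deg_bound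
  have key : ∀ (t : ℕ), ∀ i < d + t, ∀ m, M.comp i m ∈ N := by
    intro t
    induction t with
    | zero => exact fun i hi m => by rw [hd i (by simpa using hi)]; exact zero_mem _
    | succ t ih =>
      intro i hi m
      obtain ⟨x, hx, hmx⟩ := hcov m
      have h1 : M.comp i x ∈ N := by
        refine augIdeal_smul_induction (p := fun x => M.comp i x ∈ N) (fun y n => ?_) ?_ ?_ hx
        · rw [comp_smul (ι_mem_symDeg y)]
          exact N.smul_mem _ (ih _ (by push_cast at hi; omega) n)
        · rw [map_zero]
          exact zero_mem _
        · intro m m' h h'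
          rw [map_add]
          exact add_mem h h'
      have h2 := add_mem (hN i _ hmx) h1
      rwa [← map_add, sub_add_cancel] at h2
  refine eq_top_iff.2 fun m _ => ?_
  obtain ⟨s, hs⟩ := sum_comp m
  rw [← hs]
  exact sum_mem fun i _ => key (i - d + 1).toNat i (by omega) m

/-- A projective graded module is isomorphic to each of its twists: they have the same quotient
modulo the augmentation ideal, of which both are projective covers. -/
theorem IsProjective.exists_semiIso_self (hM : M.IsProjective) (g : Y ≃ₗ[ℤ] Y) :
    ∃ φ : M ≃+ M, IsSemiIso g φ := by
  let J : Submodule (SymAlg k Y) M := augIdeal k Y • ⊤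
  have hJ : ∀ i, ∀ m ∈ J, M.comp i m ∈ J := by
    intro i m hm
    refine augIdeal_smul_induction (p := fun x => M.comp i x ∈ J) (fun y n => ?_) ?_ ?_ hm
    · rw [comp_smul (ι_mem_symDeg y)]
      exact Submodule.smul_mem_smul (Ideal.subset_span ⟨y, rfl⟩) Submodule.mem_top
    · rw [map_zero]
      exact zero_mem _
    · intro m m' h h'
      rw [map_add]
      exact add_mem h h'
  have hr : IsSemiRel (M := M) (N := M) g fun m n => m - n ∈ J :=
    { add := fun {m m' n n'} h h' => by
        have := add_mem h h'
        rwa [sub_add_sub_comm] at this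
      smul := fun s m n h => by
        have h1 : (s - symMap g s) • n ∈ J :=
          Submodule.smul_mem_smul (sub_symMap_mem_augIdeal g s) Submodule.mem_top
        have := add_mem (J.smul_mem s h) h1
        rwa [smul_sub, sub_smul, sub_add_sub_cancel] at this
      comp := fun i m n h => by
        rw [← map_sub]
        exact hJ i _ h }
  obtain ⟨φ, hφ, -⟩ := hr.exists_semiIso hM hM (fun m => ⟨m, by simp⟩) (fun m => ⟨m, by simp⟩)
    (M.isSuperfluous_augIdeal_smul.mono fun m hm => by simpa [J] using hm)
    (M.isSuperfluous_augIdeal_smul.mono fun m hm => by simpa [J] using hm)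
  exact ⟨φ, hφ⟩

end GradedMod

/-! ### Braden-MacPherson sheaves on isomorphic upper sets of moment graphs -/

/-- An isomorphism, up to automorphisms `g i` of the lattice at the vertices, between an upper set
of the moment graph `G` and an upper set of the moment graph `G'`. Both upper sets are
parametrised by the type `ι`. The labels of corresponding edges `i → j` agree up to sign after
applying `g j`, and the automorphisms `g i` and `g j` agree modulo the label. -/
structure MomentGraph.UpperIso {Y : Type v} [AddCommGroup Y] {V V' : Type*} [PartialOrder V]
    [PartialOrder V'] (G : MomentGraph Y V) (G' : MomentGraph Y V') (ι : Type*) where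
  left : ι → V
  right : ι → V'
  g : ι → Y ≃ₗ[ℤ] Y
  left_injective : Function.Injective left
  right_injective : Function.Injective right
  lt_iff : ∀ {i j}, left i < left j ↔ right i < right j
  left_upper : ∀ {i v}, left i < v → ∃ j, left j = v
  right_upper : ∀ {i v}, right i < v → ∃ j, right j = v
  edge_iff : ∀ {i j}, G.Edge (left i) (left j) ↔ G'.Edge (right i) (right j)
  label : ∀ {i j} (h : G.Edge (left i) (left j)) (h' : G'.Edge (right i) (right j)),
    g j (G.label h) = G'.label h' ∨ g j (G.label h) = -G'.label h'
  congr : ∀ {i j} (h : G'.Edge (right i) (right j)) (y : Y),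
    ∃ c : ℤ, g i y - g j y = c • G'.label h

theorem exists_pi_extension {ι V : Type*} {b : ι → V} (hb : Function.Injective b)
    {β : V → Type*} [∀ v, Nonempty (β v)] (n : ∀ i, β (b i)) :
    ∃ m : ∀ v, β v, ∀ i, m (b i) = n i := by
  have h : ∀ v, ∃ x : β v, ∀ i (e : b i = v), e ▸ n i = x := by
    intro v
    by_cases h : ∃ i, b i = v
    · obtain ⟨i, rfl⟩ := h
      exact ⟨n i, fun j e => by obtain rfl := hb e; rfl⟩
    · exact ⟨Classical.arbitrary _, fun i e => (h ⟨i, e⟩).elim⟩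
  choose m hm using h
  exact ⟨m, fun i => (hm _ i rfl).symm⟩

namespace Sheaf

variable {k : Type u} [CommRing k] {Y : Type v} [AddCommGroup Y] {V V' : Type*} [PartialOrder V]
  [PartialOrder V'] {G : MomentGraph Y V} {G' : MomentGraph Y V'}

/-- The family `n` of elements of all stalks restricts to a section on the vertices above `x`. -/
def IsSectionAbove (F : Sheaf k G) (x : V) (n : ∀ v, F.stalk v) : Prop :=
  ∀ {u v} (h : G.Edge u v), x < u → F.resSource h (n u) = F.resTarget h (n v)

namespace IsBradenMacPherson

variable {F : Sheaf k G} {w : V} (hF : F.IsBradenMacPherson w)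
include hF

/-- Every element of the stalk at `x` extends to a section on the vertices above `x`. -/
theorem exists_section {x y : V} (e : G.Edge x y) (m : F.stalk x) :
    ∃ n : ∀ v, F.stalk v, F.IsSectionAbove x n ∧
      ∀ {v} (h : G.Edge x v), F.resSource h m = F.resTarget h (n v) := by
  classical
  have hm : F.toOutEdges x m ∈ F.delta x := by
    rw [← (hF.projectiveCover e).range_eq]
    exact ⟨m, rfl⟩
  obtain ⟨s, hs⟩ := hm
  let n : ∀ v, F.stalk v := fun v => if h : x < v then s.1 ⟨v, h⟩ else 0
  have hn : ∀ v (h : x < v), n v = s.1 ⟨v, h⟩ := fun v h => dif_pos h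
  refine ⟨n, fun {u v} h hu => ?_, fun {v} h => ?_⟩
  · rw [hn u hu, hn v (hu.trans (lt_of_edge h))]
    exact s.2 ⟨u, hu⟩ ⟨v, hu.trans (lt_of_edge h)⟩ h
  · rw [hn v (lt_of_edge h)]
    exact (congrFun hs ⟨v, h⟩).symm

/-- Every section on the vertices above `x` extends to `x`. -/
theorem exists_lift {x y : V} (e : G.Edge x y) {n : ∀ v, F.stalk v} (hn : F.IsSectionAbove x n) :
    ∃ m : F.stalk x, ∀ {v} (h : G.Edge x v), F.resSource h m = F.resTarget h (n v) := by
  let s : F.sections (Set.Ioi x) := ⟨fun v => n v, fun u v h => hn h u.2⟩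
  have hs : F.sectionsToOutEdges x s ∈ F.delta x := ⟨s, rfl⟩
  rw [← (hF.projectiveCover e).range_eq] at hs
  obtain ⟨m, hm⟩ := hs
  exact ⟨m, fun {v} h => congrFun hm ⟨v, h⟩⟩

theorem isSuperfluous_ker {x y : V} (e : G.Edge x y) :
    (F.stalk x).IsSuperfluous {m | ∀ {v} (h : G.Edge x v), F.resSource h m = 0} := by
  intro N hN hcov
  refine (hF.projectiveCover e).superfluous N hN (eq_top_iff.2 fun m _ => ?_)
  obtain ⟨z, hz, hmz⟩ := hcov m
  rw [← sub_add_cancel m z]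
  exact Submodule.add_mem_sup hmz (funext fun v => hz v.2)

end IsBradenMacPherson

variable {ι : Type*} (T : G.UpperIso G' ι) {F : Sheaf k G} {F' : Sheaf k G'}

/-- The maps `φ` and `ψ` on the stalks at the two ends of an edge are compatible with restriction
to the edge. -/
def IsCompatible {x y : V} {x' y' : V'} (h : G.Edge x y) (h' : G'.Edge x' y')
    (φ : F.stalk x → F'.stalk x') (ψ : F.stalk y → F'.stalk y') : Prop :=
  ∀ m n, F.resSource h m = F.resTarget h n ↔ F'.resSource h' (φ m) = F'.resTarget h' (ψ n)

section step

variable {T} {w : V} {w' : V'} (hF : F.IsBradenMacPherson w) (hF' : F'.IsBradenMacPherson w')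
include hF hF'

/-- Both kernels are the multiples of the label, and the automorphism at `j` preserves the labels up
to sign; so `φ` induces a bijection between the modules of the edges. -/
theorem resTarget_eq_zero_iff {i j : ι} (h : G.Edge (T.left i) (T.left j))
    (h' : G'.Edge (T.right i) (T.right j)) {φ : F.stalk (T.left j) ≃+ F'.stalk (T.right j)}
    (hφ : GradedMod.IsSemiIso (T.g j) φ) (n : F.stalk (T.left j)) :
    F'.resTarget h' (φ n) = 0 ↔ F.resTarget h n = 0 := by
  have hl : ∃ ε : SymAlg k Y, ε * ε = 1 ∧
      symMap (T.g j) (latticeToSym k Y (G.label h)) = ε * latticeToSym k Y (G'.label h') := by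
    rw [symMap_latticeToSym]
    rcases T.label h h' with e | e
    · exact ⟨1, by simp, by rw [e, one_mul]⟩
    · exact ⟨-1, by simp, by rw [e, latticeToSym_neg, neg_one_mul]⟩
  obtain ⟨ε, hε, hl⟩ := hl
  rw [hF.resTarget_ker, hF'.resTarget_ker]
  constructor
  · rintro ⟨n', hn'⟩
    refine ⟨φ.symm (ε • n'), φ.injective ?_⟩
    rw [hφ.map_smul, hl, AddEquiv.apply_symm_apply, hn', smul_smul, mul_right_comm, hε, one_mul]
  · rintro ⟨n', rfl⟩
    exact ⟨ε • φ n', by rw [hφ.map_smul, hl, smul_smul, mul_comm]⟩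

variable (T) in
/-- The stalks at `i` are related through the restriction maps to the edges that start at `i`, and
the isomorphisms `φ` above. -/
def edgeRel {i : ι} (φ : ∀ j, T.left i < T.left j → F.stalk (T.left j) ≃+ F'.stalk (T.right j))
    (m : F.stalk (T.left i)) (m' : F'.stalk (T.right i)) : Prop :=
  ∀ {j} (h : G.Edge (T.left i) (T.left j)) (h' : G'.Edge (T.right i) (T.right j)),
    ∃ n, F.resSource h m = F.resTarget h n ∧
      F'.resSource h' m' = F'.resTarget h' (φ j (lt_of_edge h) n)

omit hF hF' in
theorem isSemiRel_edgeRel {i : ι}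
    {φ : ∀ j, T.left i < T.left j → F.stalk (T.left j) ≃+ F'.stalk (T.right j)}
    (hφ : ∀ {j} (hj : T.left i < T.left j), GradedMod.IsSemiIso (T.g j) (φ j hj)) :
    GradedMod.IsSemiRel (T.g i) (edgeRel T φ) where
  add hm hm' _ h h' := by
    obtain ⟨n, e1, e2⟩ := hm h h'
    obtain ⟨n', e1', e2'⟩ := hm' h h'
    exact ⟨n + n', by simp [e1, e1'], by simp [e2, e2']⟩
  smul s {m m'} hm j h h' := by
    obtain ⟨n, e1, e2⟩ := hm h h'
    refine ⟨s • n, by simp [e1], ?_⟩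
    -- the two automorphisms agree modulo the label, which kills the module of the edge
    obtain ⟨c, hc⟩ := latticeToSym_dvd_symMap_sub (k := k) (T.congr h') s
    rw [(hφ (lt_of_edge h)).map_smul, map_smul, map_smul, e2, ← sub_eq_zero, ← sub_smul, hc,
      mul_comm, mul_smul, F'.label_smul, smul_zero]
  comp d {m m'} hm j h h' := by
    obtain ⟨n, e1, e2⟩ := hm h h'
    have a1 := GradedMod.map_comp (F.resSource h).toAddMonoidHom (F.resSource_degZero h) d m
    have a2 := GradedMod.map_comp (F.resTarget h).toAddMonoidHom (F.resTarget_degZero h) d n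
    have a3 := GradedMod.map_comp (F'.resSource h').toAddMonoidHom (F'.resSource_degZero h') d m'
    have a4 := GradedMod.map_comp (F'.resTarget h').toAddMonoidHom (F'.resTarget_degZero h') d
      (φ j (lt_of_edge h) n)
    refine ⟨(F.stalk _).comp d n, ?_, ?_⟩
    · exact a1.trans ((congrArg _ e1).trans a2.symm)
    · rw [(hφ (lt_of_edge h)).comp_apply]
      exact a3.trans ((congrArg _ e2).trans a4.symm)

theorem exists_edgeRel_right {i : ι}
    {φ : ∀ j, T.left i < T.left j → F.stalk (T.left j) ≃+ F'.stalk (T.right j)}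
    (hc : ∀ {j l} (hj : T.left i < T.left j) (h : G.Edge (T.left j) (T.left l))
      (h' : G'.Edge (T.right j) (T.right l)),
        IsCompatible h h' (φ j hj) (φ l (hj.trans (lt_of_edge h))))
    {j : ι} (e : G.Edge (T.left i) (T.left j)) (m : F.stalk (T.left i)) :
    ∃ m', edgeRel T φ m m' := by
  obtain ⟨n, hn, hmn⟩ := hF.exists_section e m
  obtain ⟨n', hn'⟩ := exists_pi_extension (β := fun v => F'.stalk v)
    (b := fun l : {l // T.left i < T.left l} => T.right l)
    (T.right_injective.comp Subtype.val_injective) (fun l => φ l l.2 (n (T.left l)))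
  replace hn' : ∀ l (hl : T.left i < T.left l), n' (T.right l) = φ l hl (n (T.left l)) :=
    fun l hl => hn' ⟨l, hl⟩
  have hs : F'.IsSectionAbove (T.right i) n' := by
    intro u v h hu
    obtain ⟨j, rfl⟩ := T.right_upper hu
    obtain ⟨l, rfl⟩ := T.right_upper (hu.trans (lt_of_edge h))
    have hu' := T.lt_iff.2 hu
    rw [hn' j hu', hn' l (hu'.trans (lt_of_edge (T.edge_iff.2 h)))]
    exact (hc (T.lt_iff.2 hu) (T.edge_iff.2 h) h _ _).1 (hn _ (T.lt_iff.2 hu))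
  obtain ⟨m', hm'⟩ := hF'.exists_lift (T.edge_iff.1 e) hs
  exact ⟨m', fun {l} h h' => ⟨n (T.left l), hmn h, by rw [hm' h', hn' l (lt_of_edge h)]⟩⟩

theorem exists_edgeRel_left {i : ι}
    {φ : ∀ j, T.left i < T.left j → F.stalk (T.left j) ≃+ F'.stalk (T.right j)}
    (hc : ∀ {j l} (hj : T.left i < T.left j) (h : G.Edge (T.left j) (T.left l))
      (h' : G'.Edge (T.right j) (T.right l)),
        IsCompatible h h' (φ j hj) (φ l (hj.trans (lt_of_edge h))))
    {j : ι} (e : G.Edge (T.left i) (T.left j)) (m' : F'.stalk (T.right i)) :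
    ∃ m, edgeRel T φ m m' := by
  obtain ⟨n', hn', hmn⟩ := hF'.exists_section (T.edge_iff.1 e) m'
  obtain ⟨n, hn⟩ := exists_pi_extension (β := fun v => F.stalk v)
    (b := fun l : {l // T.left i < T.left l} => T.left l)
    (T.left_injective.comp Subtype.val_injective) (fun l => (φ l l.2).symm (n' (T.right l)))
  replace hn : ∀ l (hl : T.left i < T.left l), n (T.left l) = (φ l hl).symm (n' (T.right l)) :=
    fun l hl => hn ⟨l, hl⟩
  have hs : F.IsSectionAbove (T.left i) n := by
    intro u v h hu
    obtain ⟨j, rfl⟩ := T.left_upper hu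
    obtain ⟨l, rfl⟩ := T.left_upper (hu.trans (lt_of_edge h))
    rw [hn j hu, hn l (hu.trans (lt_of_edge h)), hc hu h (T.edge_iff.1 h),
      AddEquiv.apply_symm_apply, AddEquiv.apply_symm_apply]
    exact hn' _ (T.lt_iff.1 hu)
  obtain ⟨m, hm⟩ := hF.exists_lift e hs
  exact ⟨m, fun {l} h h' => ⟨n (T.left l), hm h, by
    rw [hmn h', hn l (lt_of_edge h), AddEquiv.apply_symm_apply]⟩⟩

/-- The inductive step: isomorphisms of the stalks above `i` extend to the stalks at `i`. -/
theorem exists_semiIso_of_edge {i : ι}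
    {φ : ∀ j, T.left i < T.left j → F.stalk (T.left j) ≃+ F'.stalk (T.right j)}
    (hφ : ∀ {j} (hj : T.left i < T.left j), GradedMod.IsSemiIso (T.g j) (φ j hj))
    (hc : ∀ {j l} (hj : T.left i < T.left j) (h : G.Edge (T.left j) (T.left l))
      (h' : G'.Edge (T.right j) (T.right l)),
        IsCompatible h h' (φ j hj) (φ l (hj.trans (lt_of_edge h))))
    {j : ι} (e : G.Edge (T.left i) (T.left j)) :
    ∃ ψ : F.stalk (T.left i) ≃+ F'.stalk (T.right i), GradedMod.IsSemiIso (T.g i) ψ ∧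
      ∀ {j} (h : G.Edge (T.left i) (T.left j)) (h' : G'.Edge (T.right i) (T.right j)),
        IsCompatible h h' ψ (φ j (lt_of_edge h)) := by
  obtain ⟨ψ, hψ, hr⟩ := (isSemiRel_edgeRel (φ := φ) hφ).exists_semiIso
    (hF.projectiveCover e).projective (hF'.projectiveCover (T.edge_iff.1 e)).projective
    (exists_edgeRel_right hF hF' hc e) (exists_edgeRel_left hF hF' hc e)
    ((hF.isSuperfluous_ker e).mono fun m hm v h => by
      obtain ⟨j, rfl⟩ := T.left_upper (lt_of_edge h)
      obtain ⟨n, e1, e2⟩ := hm h (T.edge_iff.1 h)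
      rw [e1, ← resTarget_eq_zero_iff hF hF' h (T.edge_iff.1 h) (hφ (lt_of_edge h)), ← e2,
        map_zero])
    ((hF'.isSuperfluous_ker (T.edge_iff.1 e)).mono fun m hm v h => by
      obtain ⟨j, rfl⟩ := T.right_upper (lt_of_edge h)
      obtain ⟨n, e1, e2⟩ := hm (T.edge_iff.2 h) h
      rw [e2, resTarget_eq_zero_iff hF hF' (T.edge_iff.2 h) h (hφ (T.lt_iff.2 (lt_of_edge h))),
        ← e1, map_zero])
  refine ⟨ψ, hψ, fun {j} h h' m n => ?_⟩
  obtain ⟨n', e1, e2⟩ := hr m h h'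
  rw [e1, e2, ← sub_eq_zero, ← map_sub, ← sub_eq_zero (b := F'.resTarget h' (φ j (lt_of_edge h) n)),
    ← map_sub, ← map_sub, resTarget_eq_zero_iff hF hF' h h' (hφ (lt_of_edge h))]

end step

theorem exists_semiIso_of_isomorphicToSym {M N : GradedMod k Y} (hM : M.IsomorphicToSym)
    (hN : N.IsomorphicToSym) (g : Y ≃ₗ[ℤ] Y) : ∃ φ : M ≃+ N, GradedMod.IsSemiIso g φ := by
  obtain ⟨e, he⟩ := hM
  obtain ⟨f, hf⟩ := hN
  refine ⟨(e.toAddEquiv.trans (symMap g).toAddEquiv).trans f.symm.toAddEquiv, fun s m => ?_,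
    fun i m => ?_⟩
  · change f.symm (symMap g (e (s • m))) = symMap g s • f.symm (symMap g (e m))
    rw [map_smul, smul_eq_mul, map_mul, ← smul_eq_mul, map_smul]
  · change f.symm (symMap g (e m)) ∈ _ ↔ _
    rw [hf, LinearEquiv.apply_symm_apply, symMap_mem_symDeg_iff, he]

/-- The stalks of Braden-MacPherson sheaves at corresponding vertices of isomorphic upper sets are
isomorphic, up to a twist: isomorphisms compatible with the restriction maps are constructed from
the top down. -/
theorem exists_semiIso_stalk {w : V} {w' : V'} (hF : F.IsBradenMacPherson w)
    (hF' : F'.IsBradenMacPherson w') (hw : IsMax w)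
    (hout : ∀ i, (T.left i = w ∧ T.right i = w') ∨ ∃ j, G.Edge (T.left i) (T.left j))
    (rk : ι → ℕ) (hrk : ∀ {i j}, T.left i < T.left j → rk j < rk i) (i : ι) :
    ∃ φ : F.stalk (T.left i) ≃+ F'.stalk (T.right i), GradedMod.IsSemiIso (T.g i) φ := by
  classical
  have key : ∀ N : ℕ, ∃ φ : ∀ j, rk j < N → F.stalk (T.left j) ≃+ F'.stalk (T.right j),
      (∀ j hj, GradedMod.IsSemiIso (T.g j) (φ j hj)) ∧
      ∀ j l hj hl (h : G.Edge (T.left j) (T.left l)) (h' : G'.Edge (T.right j) (T.right l)),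
        IsCompatible h h' (φ j hj) (φ l hl) := by
    intro N
    induction N with
    | zero => exact ⟨fun j hj => absurd hj (by omega), fun j hj => absurd hj (by omega),
        fun j l hj => absurd hj (by omega)⟩
    | succ N ih =>
      obtain ⟨φ, hφ, hc⟩ := ih
      have hstep : ∀ j, rk j = N → ∃ ψ : F.stalk (T.left j) ≃+ F'.stalk (T.right j),
          GradedMod.IsSemiIso (T.g j) ψ ∧
          ∀ l hl (h : G.Edge (T.left j) (T.left l)) (h' : G'.Edge (T.right j) (T.right l)),
            IsCompatible h h' ψ (φ l hl) := by
        intro j hj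
        rcases hout j with ⟨e, e'⟩ | ⟨l, h⟩
        · obtain ⟨ψ, hψ⟩ := exists_semiIso_of_isomorphicToSym (M := F.stalk (T.left j))
            (N := F'.stalk (T.right j)) (by rw [e]; exact hF.top_stalk)
            (by rw [e']; exact hF'.top_stalk) (T.g j)
          exact ⟨ψ, hψ, fun l _ h => (hw.not_lt (e ▸ lt_of_edge h)).elim⟩
        · obtain ⟨ψ, hψ, hψc⟩ := exists_semiIso_of_edge hF hF' (T := T) (i := j)
            (φ := fun l hl => φ l (hj ▸ hrk hl)) (fun _ => hφ _ _) (fun _ h h' => hc _ _ _ _ h h') h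
          exact ⟨ψ, hψ, fun l _ h h' => hψc h h'⟩
      choose ψ hψ hψc using hstep
      have hN : ∀ {j}, rk j < N + 1 → ¬ rk j < N → rk j = N := by omega
      refine ⟨fun j hj => if h : rk j < N then φ j h else ψ j (hN hj h), fun j hj => ?_,
        fun j l hj hl h h' => ?_⟩
      · dsimp only
        by_cases h : rk j < N
        · rw [dif_pos h]
          exact hφ j h
        · rw [dif_neg h]
          exact hψ j _
      · have hlN : rk l < N := by
          have := hrk (lt_of_edge h)
          omega
        dsimp only
        rw [dif_pos hlN]
        by_cases hjN : rk j < N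
        · rw [dif_pos hjN]
          exact hc _ _ _ _ h h'
        · rw [dif_neg hjN]
          exact hψc j _ l hlN h h'
  obtain ⟨φ, hφ, -⟩ := key (rk i + 1)
  exact ⟨φ i (by omega), hφ i _⟩

end Sheaf

namespace Realisation
variable {n : ℕ} {C : CartanMat n} {𝔥 : Type v} [AddCommGroup 𝔥] [Module ℂ 𝔥]
  (R : Realisation C 𝔥)

/-! ### Words in the simple reflections, and the action on roots -/

theorem toGL_simple_apply (i : Fin n) (x : 𝔥) :
    R.toGL (R.simple i) x = x - R.root i x • R.coroot i := by
  change R.simpleReflection i x = _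
  rw [simpleReflection, Module.reflection_apply]

theorem toGL_mul_apply (u v : R.Weyl) (x : 𝔥) : R.toGL (u * v) x = R.toGL u (R.toGL v x) := by
  rw [map_mul, LinearEquiv.mul_apply]

theorem toGL_inv_apply_self (u : R.Weyl) (x : 𝔥) : R.toGL u⁻¹ (R.toGL u x) = x := by
  rw [← toGL_mul_apply]
  simp

theorem toGL_apply_inv_self (u : R.Weyl) (x : 𝔥) : R.toGL u (R.toGL u⁻¹ x) = x := by
  rw [← toGL_mul_apply]
  simp

theorem toGL_injective : Function.Injective R.toGL := Subtype.val_injective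

@[simp]
theorem simple_mul_simple (i : Fin n) : R.simple i * R.simple i = 1 := by
  apply R.toGL_injective
  ext x
  rw [toGL_mul_apply]
  exact (Module.involutive_reflection (R.root_coroot_self i) x).trans (by simp)

@[simp]
theorem simple_inv (i : Fin n) : (R.simple i)⁻¹ = R.simple i :=
  inv_eq_of_mul_eq_one_left (R.simple_mul_simple i)

@[simp]
theorem mul_simple_mul_simple (w : R.Weyl) (i : Fin n) : w * R.simple i * R.simple i = w := by
  rw [mul_assoc, simple_mul_simple, mul_one]

/-- The product of the simple reflections given by a word. -/
def wordProd (l : List (Fin n)) : R.Weyl := (l.map R.simple).prod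

@[simp] theorem wordProd_nil : R.wordProd [] = 1 := rfl

@[simp] theorem wordProd_cons (i : Fin n) (l : List (Fin n)) :
    R.wordProd (i :: l) = R.simple i * R.wordProd l := by simp [wordProd]

@[simp] theorem wordProd_append (l l' : List (Fin n)) :
    R.wordProd (l ++ l') = R.wordProd l * R.wordProd l' := by simp [wordProd]

theorem wordProd_reverse (l : List (Fin n)) : R.wordProd l.reverse = (R.wordProd l)⁻¹ := by
  induction l with
  | nil => simp
  | cons i l ih => simp [ih]

theorem exists_wordProd (w : R.Weyl) : ∃ l, R.wordProd l = w := by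
  obtain ⟨g, hg⟩ := w
  suffices h : ∃ l, R.toGL (R.wordProd l) = g by
    obtain ⟨l, hl⟩ := h
    exact ⟨l, R.toGL_injective hl⟩
  have hs : ∀ i, R.toGL (R.simple i) = R.simpleReflection i := fun _ => rfl
  induction hg using Subgroup.closure_induction with
  | mem x hx =>
    obtain ⟨i, rfl⟩ := hx
    exact ⟨[i], by simp [hs]⟩
  | one => exact ⟨[], by simp⟩
  | mul x y _ _ hx hy =>
    obtain ⟨l, rfl⟩ := hx
    obtain ⟨l', rfl⟩ := hy
    exact ⟨l ++ l', by simp⟩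
  | inv x _ hx =>
    obtain ⟨l, rfl⟩ := hx
    exact ⟨l.reverse, by rw [wordProd_reverse, map_inv]⟩

theorem length_wordProd_le (l : List (Fin n)) : R.length (R.wordProd l) ≤ l.length :=
  Nat.sInf_le ⟨l, rfl, rfl⟩

theorem exists_reduced_word (w : R.Weyl) :
    ∃ l : List (Fin n), l.length = R.length w ∧ R.wordProd l = w := by
  obtain ⟨l, hl⟩ := R.exists_wordProd w
  exact Nat.sInf_mem (s := {m | ∃ l : List (Fin n), l.length = m ∧ (l.map R.simple).prod = w})
    ⟨_, l, rfl, hl⟩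

theorem length_mul_le (v w : R.Weyl) : R.length (v * w) ≤ R.length v + R.length w := by
  obtain ⟨l, hl, rfl⟩ := R.exists_reduced_word v
  obtain ⟨l', hl', rfl⟩ := R.exists_reduced_word w
  rw [← hl, ← hl', ← wordProd_append, ← List.length_append]
  exact R.length_wordProd_le _

theorem length_simple_le (i : Fin n) : R.length (R.simple i) ≤ 1 := by
  simpa using R.length_wordProd_le [i]

theorem length_inv (w : R.Weyl) : R.length w⁻¹ = R.length w := by
  have h : ∀ w, R.length w⁻¹ ≤ R.length w := by
    intro w
    obtain ⟨l, hl, rfl⟩ := R.exists_reduced_word w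
    rw [← wordProd_reverse, ← hl, ← List.length_reverse (as := l)]
    exact R.length_wordProd_le _
  exact le_antisymm (h w) (by simpa using h w⁻¹)

/-- The contragredient action of the Weyl group on the dual of `𝔥`. -/
def dualAct (u : R.Weyl) : Module.Dual ℂ 𝔥 →ₗ[ℂ] Module.Dual ℂ 𝔥 :=
  (R.toGL u⁻¹).toLinearMap.dualMap

theorem dualAct_apply (u : R.Weyl) (α : Module.Dual ℂ 𝔥) (x : 𝔥) :
    R.dualAct u α x = α (R.toGL u⁻¹ x) := rfl

theorem dualAct_mul (u v : R.Weyl) (α : Module.Dual ℂ 𝔥) :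
    R.dualAct (u * v) α = R.dualAct u (R.dualAct v α) := by
  ext x
  simp only [dualAct_apply, mul_inv_rev, toGL_mul_apply]

@[simp]
theorem dualAct_one (α : Module.Dual ℂ 𝔥) : R.dualAct 1 α = α := by
  ext x
  simp [dualAct_apply]

theorem dualAct_root (u : R.Weyl) (i : Fin n) : R.dualAct u (R.root i) = R.realRoot u i := rfl

theorem dualAct_realRoot (u v : R.Weyl) (i : Fin n) :
    R.dualAct u (R.realRoot v i) = R.realRoot (u * v) i := by
  rw [← dualAct_root, ← dualAct_root, dualAct_mul]

@[simp]
theorem realRoot_one (i : Fin n) : R.realRoot 1 i = R.root i := by rw [← dualAct_root, dualAct_one]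

theorem dualAct_simple (i : Fin n) (α : Module.Dual ℂ 𝔥) :
    R.dualAct (R.simple i) α = α - α (R.coroot i) • R.root i := by
  ext x
  rw [dualAct_apply, simple_inv, toGL_simple_apply]
  simp [mul_comm]

theorem dualAct_simple_root (i j : Fin n) :
    R.dualAct (R.simple i) (R.root j) = R.root j - C.A i j • R.root i := by
  rw [dualAct_simple, R.pairing, Int.cast_smul_eq_zsmul]

theorem realRoot_mul_simple_self (u : R.Weyl) (i : Fin n) :
    R.realRoot (u * R.simple i) i = -R.realRoot u i := by
  rw [← dualAct_root, dualAct_mul, dualAct_simple_root, C.diag, map_sub, map_zsmul, dualAct_root]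
  abel

theorem realRoot_realCoroot (u : R.Weyl) (i : Fin n) : R.realRoot u i (R.realCoroot u i) = 2 := by
  rw [← R.root_coroot_self i]
  change R.root i (R.toGL u⁻¹ (R.toGL u (R.coroot i))) = _
  rw [toGL_inv_apply_self]

theorem realRoot_ne_zero (u : R.Weyl) (i : Fin n) : R.realRoot u i ≠ 0 := by
  intro h
  have := R.realRoot_realCoroot u i
  simp [h] at this

theorem toGL_realCoroot (u v : R.Weyl) (i : Fin n) :
    R.toGL u (R.realCoroot v i) = R.realCoroot (u * v) i := (R.toGL_mul_apply u v _).symm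

theorem refl_mul (u v : R.Weyl) (i : Fin n) : R.refl (u * v) i = u * R.refl v i * u⁻¹ := by
  simp [refl, mul_assoc]

@[simp]
theorem refl_one (i : Fin n) : R.refl 1 i = R.simple i := by simp [refl]

theorem refl_mul_simple_self (u : R.Weyl) (i : Fin n) :
    R.refl (u * R.simple i) i = R.refl u i := by
  simp [refl, mul_assoc]

@[simp]
theorem refl_mul_refl (u : R.Weyl) (i : Fin n) : R.refl u i * R.refl u i = 1 := by
  have h : R.refl u i * R.refl u i = u * (R.simple i * R.simple i) * u⁻¹ := by
    simp only [refl]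
    group
  simpa using h

/-! ### Integrality -/

theorem realRoot_eq_sum (u : R.Weyl) (i : Fin n) :
    ∃ c : Fin n → ℤ, R.realRoot u i = ∑ j, (c j : ℂ) • R.root j := by
  have h : ∀ l, R.realRoot (R.wordProd l) i ∈ Submodule.span ℤ (Set.range R.root) := by
    intro l
    induction l with
    | nil =>
      rw [wordProd_nil, realRoot_one]
      exact Submodule.subset_span ⟨i, rfl⟩
    | cons j l ih =>
      rw [wordProd_cons, ← dualAct_realRoot]
      generalize R.realRoot (R.wordProd l) i = β at ih
      induction ih using Submodule.span_induction with
      | mem x hx =>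
        obtain ⟨m, rfl⟩ := hx
        rw [dualAct_simple_root]
        exact sub_mem (Submodule.subset_span ⟨m, rfl⟩)
          (Submodule.smul_mem _ _ (Submodule.subset_span ⟨j, rfl⟩))
      | zero => rw [map_zero]; exact zero_mem _
      | add x y _ _ hx hy => rw [map_add]; exact add_mem hx hy
      | smul a x _ hx => rw [map_zsmul]; exact Submodule.smul_mem _ _ hx
  obtain ⟨l, rfl⟩ := R.exists_wordProd u
  obtain ⟨c, hc⟩ := (Submodule.mem_span_range_iff_exists_fun ℤ).1 (h l)
  exact ⟨c, by simp [← hc, Int.cast_smul_eq_zsmul]⟩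

theorem mem_corootLattice_iff {x : 𝔥} :
    x ∈ R.corootLattice ↔ ∃ c : Fin n → ℤ, x = ∑ j, (c j : ℂ) • R.coroot j := by
  rw [corootLattice, Submodule.mem_span_range_iff_exists_fun]
  simp [Int.cast_smul_eq_zsmul, eq_comm]

theorem root_apply_int (i : Fin n) {x : 𝔥} (hx : x ∈ R.corootLattice) :
    ∃ c : ℤ, R.root i x = c := by
  obtain ⟨c, rfl⟩ := R.mem_corootLattice_iff.1 hx
  refine ⟨∑ j, c j * C.A j i, ?_⟩
  simp [R.pairing]

theorem root_coeff_unique {c d : Fin n → ℂ} (h : ∑ j, c j • R.root j = ∑ j, d j • R.root j) :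
    c = d := by
  have h' := Fintype.linearIndependent_iff.1 R.root_independent (fun j => c j - d j)
    (by simp [sub_smul, h])
  exact funext fun j => sub_eq_zero.1 (h' j)

theorem coroot_coeff_unique {c d : Fin n → ℂ}
    (h : ∑ j, c j • R.coroot j = ∑ j, d j • R.coroot j) : c = d := by
  have h' := Fintype.linearIndependent_iff.1 R.coroot_independent (fun j => c j - d j)
    (by simp [sub_smul, h])
  exact funext fun j => sub_eq_zero.1 (h' j)

theorem coeff_int_of_realCoroot_eq_smul {u v : R.Weyl} {i j : Fin n} {c : ℂ}
    (h : R.realCoroot v j = c • R.realCoroot u i) : ∃ a : ℤ, c = a := by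
  have h1 : R.realCoroot (u⁻¹ * v) j = c • R.coroot i := by
    rw [← toGL_realCoroot, h, map_smul, toGL_realCoroot, inv_mul_cancel]
    simp [realCoroot]
  obtain ⟨a, ha⟩ := R.mem_corootLattice_iff.1 (R.realCoroot_mem (u⁻¹ * v) j)
  have h2 : ∑ m, (a m : ℂ) • R.coroot m = ∑ m, (Pi.single i c : Fin n → ℂ) m • R.coroot m := by
    rw [← ha, h1]
    simp [Pi.single_apply, ite_smul]
  have := congrFun (R.coroot_coeff_unique h2) i
  exact ⟨a i, by simpa using this.symm⟩

/-- A reflection determines its coroot up to sign. -/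
theorem realCoroot_eq_or_eq_neg {u v : R.Weyl} {i j : Fin n} (h : R.refl u i = R.refl v j) :
    R.realCoroot u i = R.realCoroot v j ∨ R.realCoroot u i = -R.realCoroot v j := by
  have key : ∀ {u v : R.Weyl} {i j : Fin n}, R.refl u i = R.refl v j →
      ∃ a : ℤ, R.realCoroot v j = (a : ℂ) • R.realCoroot u i := by
    intro u v i j h
    have h1 := R.refl_apply u i (R.realCoroot v j)
    rw [h, R.refl_apply, realRoot_realCoroot, sub_right_inj] at h1
    have h2 : R.realCoroot v j =
        (R.realRoot u i (R.realCoroot v j) / 2) • R.realCoroot u i := by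
      rw [div_eq_inv_mul, mul_smul, ← h1, smul_smul]
      norm_num
    obtain ⟨a, ha⟩ := R.coeff_int_of_realCoroot_eq_smul h2
    exact ⟨a, by rwa [ha] at h2⟩
  obtain ⟨a, ha⟩ := key h
  obtain ⟨b, hb⟩ := key h.symm
  have hab : a * b = 1 := by
    have h1 : ((b : ℂ) * a - 1) • R.realCoroot u i = 0 := by
      rw [sub_smul, mul_smul, ← ha, ← hb, one_smul, sub_self]
    have h2 := (smul_eq_zero.1 h1).resolve_right (R.realCoroot_ne_zero u i)
    have h3 : (b : ℂ) * a = 1 := sub_eq_zero.1 h2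
    rw [mul_comm]
    exact_mod_cast h3
  rcases Int.eq_one_or_neg_one_of_mul_eq_one' hab with ⟨-, rfl⟩ | ⟨-, rfl⟩
  · exact Or.inl (by simpa using hb)
  · exact Or.inr (by simpa using hb)

/-! ### Positive roots -/

variable {R}

theorem IsPositive.add {α β : Module.Dual ℂ 𝔥} (hα : R.IsPositive α) (hβ : R.IsPositive β) :
    R.IsPositive (α + β) := by
  obtain ⟨c, rfl⟩ := hα
  obtain ⟨d, rfl⟩ := hβ
  exact ⟨c + d, by simp [add_smul, Finset.sum_add_distrib]⟩

theorem IsPositive.zsmul {α : Module.Dual ℂ 𝔥} (hα : R.IsPositive α) {p : ℤ} (hp : 0 ≤ p) :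
    R.IsPositive (p • α) := by
  lift p to ℕ using hp
  obtain ⟨c, rfl⟩ := hα
  exact ⟨fun j => p * c j, by simp [Finset.smul_sum, mul_smul]⟩

variable (R)

theorem isPositive_root (i : Fin n) : R.IsPositive (R.root i) :=
  ⟨Pi.single i 1, by simp [Pi.single_apply, ite_smul]⟩

theorem eq_zero_of_isPositive_neg {α : Module.Dual ℂ 𝔥} (h : R.IsPositive α)
    (h' : R.IsPositive (-α)) : α = 0 := by
  obtain ⟨c, rfl⟩ := h
  obtain ⟨d, hd⟩ := h'
  have h1 : ∑ j, ((c j + d j : ℕ) : ℂ) • R.root j = ∑ j, (0 : ℂ) • R.root j := by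
    simp only [Nat.cast_smul_eq_nsmul, add_smul, Finset.sum_add_distrib, ← hd]
    simp
  have h2 := R.root_coeff_unique h1
  refine Finset.sum_eq_zero fun j _ => ?_
  have h3 : c j + d j = 0 := by exact_mod_cast congrFun h2 j
  rw [show c j = 0 by omega, zero_smul]

/-- The simple reflection `s_j` permutes the positive real roots other than `α_j`. -/
theorem eq_root_of_isPositive {u : R.Weyl} {i j : Fin n} (h : R.IsPositive (R.realRoot u i))
    (h' : R.IsPositive (-R.dualAct (R.simple j) (R.realRoot u i))) : R.realRoot u i = R.root j := by
  obtain ⟨c, hc⟩ := h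
  obtain ⟨d, hd⟩ := h'
  set N := R.realRoot u i (R.coroot j)
  have h1 : ∑ m, ((c m + d m : ℕ) : ℂ) • R.root m =
      ∑ m, (Pi.single j N : Fin n → ℂ) m • R.root m := by
    simp only [Nat.cast_smul_eq_nsmul, add_smul, Finset.sum_add_distrib, ← hd, ← hc, dualAct_simple]
    simp [Pi.single_apply, ite_smul, N]
  have h2 := R.root_coeff_unique h1
  have h3 : ∀ m, m ≠ j → c m = 0 := by
    intro m hm
    have := congrFun h2 m
    rw [Pi.single_eq_of_ne hm] at this
    have : c m + d m = 0 := by exact_mod_cast this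
    omega
  have h4 : R.realRoot u i = c j • R.root j := by
    rw [hc, Finset.sum_eq_single j (fun m _ hm => by rw [h3 m hm, zero_smul]) (by simp)]
  -- apply `u⁻¹`: the coefficient of `α_i` in `c_j u⁻¹ α_j = α_i` is one
  obtain ⟨e, he⟩ := R.realRoot_eq_sum u⁻¹ j
  have h5 : R.root i = c j • R.realRoot u⁻¹ j := by
    rw [← dualAct_root, ← map_nsmul, ← h4, dualAct_realRoot, inv_mul_cancel, realRoot_one]
  have h6 : ∑ m, ((c j * e m : ℤ) : ℂ) • R.root m =
      ∑ m, (Pi.single i 1 : Fin n → ℂ) m • R.root m := by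
    rw [he, Finset.smul_sum] at h5
    simp only [Int.cast_mul, Int.cast_natCast, mul_smul, Nat.cast_smul_eq_nsmul, ← h5]
    simp [Pi.single_apply, ite_smul]
  have h7 := congrFun (R.root_coeff_unique h6) i
  rw [Pi.single_eq_same] at h7
  have h8 : (c j : ℤ) * e i = 1 := by exact_mod_cast h7
  have h9 : c j = 1 := by
    have := Int.eq_one_or_neg_one_of_mul_eq_one h8
    omega
  rw [h4, h9, one_smul]

/-- The coroot of a real root is determined by the root. This uses that the Cartan matrix is
symmetrisable: the span of the elements `(α_i^∨, d_i⁻¹ α_i)` is the graph of an equivariant map. -/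
theorem realCoroot_eq_coroot {u : R.Weyl} {i j : Fin n} (h : R.realRoot u i = R.root j) :
    R.realCoroot u i = R.coroot j := by
  obtain ⟨d, hd0, hd⟩ := C.symmetrisable
  let γ : Fin n → 𝔥 × Module.Dual ℂ 𝔥 := fun m => (R.coroot m, (d m)⁻¹ • R.root m)
  let D := Submodule.span ℂ (Set.range γ)
  have hγ : ∀ m, γ m ∈ D := fun m => Submodule.subset_span ⟨m, rfl⟩
  have hsimple : ∀ m, ∀ x ∈ D, (R.toGL (R.simple m) x.1, R.dualAct (R.simple m) x.2) ∈ D := by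
    intro m x hx
    induction hx using Submodule.span_induction with
    | mem x hx =>
      obtain ⟨p, rfl⟩ := hx
      have : (R.toGL (R.simple m) (γ p).1, R.dualAct (R.simple m) (γ p).2) =
          γ p - (C.A p m : ℂ) • γ m := by
        refine Prod.ext ?_ ?_
        · simp [γ, toGL_simple_apply, R.pairing]
        · have hpm : (d p)⁻¹ * (C.A m p : ℂ) = (C.A p m : ℂ) * (d m)⁻¹ := by
            have := hd p m
            field_simp [hd0 p, hd0 m]
            linear_combination -this
          simp [γ, dualAct_simple, R.pairing, smul_sub, smul_smul, hpm]
      rw [this]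
      exact sub_mem (hγ p) (D.smul_mem _ (hγ m))
    | zero =>
      simp only [Prod.fst_zero, Prod.snd_zero, map_zero]
      exact D.zero_mem
    | add x y _ _ hx hy => simpa using add_mem hx hy
    | smul a x _ hx => simpa using D.smul_mem a hx
  have hword : ∀ l, (R.realCoroot (R.wordProd l) i, (d i)⁻¹ • R.realRoot (R.wordProd l) i) ∈ D := by
    intro l
    induction l with
    | nil => simpa [realCoroot] using hγ i
    | cons m l ih =>
      have := hsimple m _ ih
      simpa only [map_smul, toGL_realCoroot, dualAct_realRoot, ← wordProd_cons] using this
  obtain ⟨l, rfl⟩ := R.exists_wordProd u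
  have h1 := hword l
  rw [h] at h1
  have h2 := sub_mem h1 (D.smul_mem (d j / d i) (hγ j))
  have h3 : ((R.realCoroot (R.wordProd l) i, (d i)⁻¹ • R.root j) : 𝔥 × Module.Dual ℂ 𝔥) -
      (d j / d i) • γ j = (R.realCoroot (R.wordProd l) i - (d j / d i) • R.coroot j, 0) := by
    refine Prod.ext rfl ?_
    simp only [γ, Prod.snd_sub, Prod.smul_snd, smul_smul]
    rw [← sub_smul]
    have : (d i)⁻¹ - d j / d i * (d j)⁻¹ = 0 := by
      field_simp [hd0 i, hd0 j]
      simp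
    rw [this, zero_smul]
  rw [h3] at h2
  obtain ⟨c, hc⟩ := (Submodule.mem_span_range_iff_exists_fun ℂ).1 h2
  have h4 : ∑ m, (c m * (d m)⁻¹) • R.root m = ∑ m, (0 : ℂ) • R.root m := by
    have := congrArg Prod.snd hc
    simpa [γ, Prod.snd_sum, smul_smul] using this
  have h5 : ∀ m, c m = 0 := fun m => by
    have := congrFun (R.root_coeff_unique h4) m
    simpa [hd0 m] using this
  have h6 : R.realCoroot (R.wordProd l) i - (d j / d i) • R.coroot j = 0 := by
    have := congrArg Prod.fst hc
    simpa [γ, Prod.fst_sum, h5] using this.symm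
  rw [sub_eq_zero] at h6
  have h7 := R.realRoot_realCoroot (R.wordProd l) i
  rw [h, h6, map_smul, root_coroot_self, smul_eq_mul] at h7
  have h8 : d j / d i = 1 := by linear_combination h7 / 2
  rw [h6, h8, one_smul]

theorem refl_eq_simple {u : R.Weyl} {i j : Fin n} (h : R.realRoot u i = R.root j) :
    R.refl u i = R.simple j := by
  apply R.toGL_injective
  ext x
  rw [refl_apply, toGL_simple_apply, h, R.realCoroot_eq_coroot h]

/-! ### Real roots are positive or negative -/

/-- The exchange property of words in a set `I` of simple reflections, for which the real roots in
the orbits of the simple roots in `I` are known to be positive or negative. -/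
theorem exists_shorter_word {I : Set (Fin n)}
    (hI : ∀ l : List (Fin n), (∀ m ∈ l, m ∈ I) → ∀ m ∈ I,
      R.IsPositive (R.realRoot (R.wordProd l) m) ∨ R.IsPositive (-R.realRoot (R.wordProd l) m))
    {lu : List (Fin n)} (hlu : ∀ m ∈ lu, m ∈ I) {i : Fin n} (hi : i ∈ I)
    (hpos : R.IsPositive (R.realRoot (R.wordProd lu) i))
    {l : List (Fin n)} (hl : ∀ m ∈ l, m ∈ I)
    (hneg : R.IsPositive (-R.realRoot (R.wordProd l * R.wordProd lu) i)) :
    ∃ l' : List (Fin n), (∀ m ∈ l', m ∈ I) ∧ l'.length < l.length ∧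
      R.wordProd l' = R.wordProd l * R.refl (R.wordProd lu) i := by
  induction l with
  | nil =>
    rw [wordProd_nil, one_mul] at hneg
    exact (R.realRoot_ne_zero _ _ (R.eq_zero_of_isPositive_neg hpos hneg)).elim
  | cons j l ih =>
    have hl' : ∀ m ∈ l, m ∈ I := fun m hm => hl m (List.mem_cons_of_mem _ hm)
    have hsign := hI (l ++ lu) (fun m hm => (List.mem_append.1 hm).elim (hl' m) (hlu m)) i hi
    rw [wordProd_append] at hsign
    rcases hsign with h | h
    · rw [wordProd_cons, mul_assoc, ← dualAct_realRoot] at hneg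
      have h1 := R.refl_eq_simple (R.eq_root_of_isPositive h hneg)
      refine ⟨l, hl', by simp, ?_⟩
      rw [refl_mul, mul_inv_eq_iff_eq_mul] at h1
      rw [wordProd_cons, mul_assoc, h1, ← mul_assoc, simple_mul_simple, one_mul]
    · obtain ⟨l', h1, h2, h3⟩ := ih hl' h
      refine ⟨j :: l', ?_, by simpa using h2, by rw [wordProd_cons, wordProd_cons, h3, mul_assoc]⟩
      rintro m (_ | ⟨_, hm⟩)
      · exact hl _ (by simp)
      · exact h1 m hm

end Realisation

namespace Realisation
variable {n : ℕ} {C : CartanMat n} {𝔥 : Type v} [AddCommGroup 𝔥] [Module ℂ 𝔥]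
  (R : Realisation C 𝔥)

/-- In rank two, the coordinates `(p, q)` of a real root have the same sign: they satisfy
`b p² - a b p q + a q² ∈ {a, b}`, where `-a` and `-b` are the off-diagonal entries of the Cartan
matrix. -/
theorem exists_coord_rank_two {i j : Fin n} (hij : i ≠ j) {l : List (Fin n)}
    (hl : ∀ m ∈ l, m ∈ ({i, j} : Set (Fin n))) {m : Fin n} (hm : m ∈ ({i, j} : Set (Fin n))) :
    ∃ p q : ℤ, R.realRoot (R.wordProd l) m = p • R.root i + q • R.root j ∧
      ((0 ≤ p ∧ 0 ≤ q) ∨ (p ≤ 0 ∧ q ≤ 0)) := by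
  obtain ⟨a, ha⟩ : ∃ a, C.A i j = -a := ⟨-C.A i j, by simp⟩
  obtain ⟨b, hb⟩ : ∃ b, C.A j i = -b := ⟨-C.A j i, by simp⟩
  have ha0 : 0 ≤ a := by have := C.offDiag i j hij; omega
  have hb0 : 0 ≤ b := by have := C.offDiag j i hij.symm; omega
  have hab : a = 0 ↔ b = 0 := by have := C.zero_iff i j; omega
  have key : ∃ p q : ℤ, R.realRoot (R.wordProd l) m = p • R.root i + q • R.root j ∧
      ((a = 0 ∧ b = 0 ∧ ((p ^ 2 = 1 ∧ q = 0) ∨ (p = 0 ∧ q ^ 2 = 1))) ∨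
        (0 < a ∧ 0 < b ∧ (b * p ^ 2 - a * b * p * q + a * q ^ 2 = a ∨
          b * p ^ 2 - a * b * p * q + a * q ^ 2 = b))) := by
    induction l with
    | nil =>
      rw [wordProd_nil, realRoot_one]
      rcases hm with rfl | rfl
      · refine ⟨1, 0, by simp, ?_⟩
        by_cases h : a = 0
        · exact Or.inl ⟨h, hab.1 h, by simp⟩
        · exact Or.inr ⟨by omega, by omega, by simp⟩
      · refine ⟨0, 1, by simp, ?_⟩
        by_cases h : a = 0
        · exact Or.inl ⟨h, hab.1 h, by simp⟩
        · exact Or.inr ⟨by omega, by omega, by simp⟩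
    | cons t l ih =>
      obtain ⟨p, q, hpq, h⟩ := ih fun m hm => hl m (List.mem_cons_of_mem _ hm)
      rw [wordProd_cons, ← dualAct_realRoot, hpq, map_add, map_zsmul, map_zsmul]
      have ht := hl t (by simp)
      rcases ht with rfl | rfl
      · refine ⟨-p + a * q, q, ?_, ?_⟩
        · rw [dualAct_simple_root, dualAct_simple_root, C.diag, ha]
          module
        · rcases h with ⟨rfl, rfl, h⟩ | ⟨h1, h2, h⟩
          · exact Or.inl ⟨rfl, rfl, by simpa using h⟩
          · refine Or.inr ⟨h1, h2, ?_⟩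
            convert h using 2 <;> ring
      · refine ⟨p, b * p - q, ?_, ?_⟩
        · rw [dualAct_simple_root, dualAct_simple_root, C.diag, hb]
          module
        · rcases h with ⟨rfl, rfl, h⟩ | ⟨h1, h2, h⟩
          · exact Or.inl ⟨rfl, rfl, by simpa using h⟩
          · refine Or.inr ⟨h1, h2, ?_⟩
            convert h using 2 <;> ring
  obtain ⟨p, q, hpq, h⟩ := key
  refine ⟨p, q, hpq, ?_⟩
  rcases h with ⟨-, -, ⟨-, h⟩ | ⟨h, -⟩⟩ | ⟨h1, h2, h⟩
  · omega
  · omega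
  · by_contra hcon
    have hneg : p * q ≤ -1 := by
      rcases lt_trichotomy p 0 with hp | hp | hp
      · have : 0 < q := by omega
        nlinarith
      · omega
      · have : q < 0 := by omega
        nlinarith
    have hp : 1 ≤ p ^ 2 := by
      have : p ≠ 0 := by rintro rfl; simp at hneg
      have := pow_pos (abs_pos.2 this) 2
      rw [sq_abs] at this
      omega
    have hq : 1 ≤ q ^ 2 := by
      have : q ≠ 0 := by rintro rfl; simp at hneg
      have := pow_pos (abs_pos.2 this) 2
      rw [sq_abs] at this
      omega
    have e1 : b * 1 ≤ b * p ^ 2 := mul_le_mul_of_nonneg_left hp hb0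
    have e2 : a * 1 ≤ a * q ^ 2 := mul_le_mul_of_nonneg_left hq ha0
    have e3 : 0 < a * b := mul_pos h1 h2
    have e4 : a * b * (p * q) ≤ a * b * (-1) := mul_le_mul_of_nonneg_left hneg e3.le
    have e5 : a * b * p * q = a * b * (p * q) := by ring
    rcases h with h | h <;> linarith

/-- If `w s_i` is not shorter than `w`, then `w α_i` is a positive root. One splits off from `w` a
maximal right factor in a rank two parabolic subgroup containing `s_i`. -/
theorem isPositive_of_length_le {w : R.Weyl} {i : Fin n}
    (h : R.length w ≤ R.length (w * R.simple i)) : R.IsPositive (R.realRoot w i) := by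
  classical
  induction hN : R.length w using Nat.strong_induction_on generalizing w i with
  | _ N ih =>
  obtain ⟨l, hl, hlw⟩ := R.exists_reduced_word w
  rcases List.eq_nil_or_concat' l with rfl | ⟨l, j, rfl⟩
  · rw [← hlw, wordProd_nil, realRoot_one]
    exact R.isPositive_root i
  have hNl : l.length + 1 = N := by simpa [hN] using hl
  have hwj : w = R.wordProd l * R.simple j := by rw [← hlw]; simp
  have hlj : R.length (R.wordProd l) < N := by
    have := R.length_wordProd_le l
    omega
  have hij : i ≠ j := by
    rintro rfl
    rw [hwj, mul_simple_mul_simple, ← hwj] at h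
    omega
  let I : Set (Fin n) := {i, j}
  have hiI : i ∈ I := Or.inl rfl
  have hjI : j ∈ I := Or.inr rfl
  let p : ℕ → Prop := fun m => ∃ v : R.Weyl, ∃ l' : List (Fin n), (∀ x ∈ l', x ∈ I) ∧
    w = v * R.wordProd l' ∧ R.length v = m ∧ m + l'.length = N
  have hp : p (R.length (R.wordProd l)) := by
    refine ⟨R.wordProd l, [j], by simpa using hjI, by simpa using hwj, rfl, ?_⟩
    have h1 := R.length_mul_le (R.wordProd l) (R.simple j)
    have h2 := R.length_simple_le j
    rw [← hwj] at h1
    simp only [List.length_singleton]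
    omega
  have hex : ∃ m, p m := ⟨_, hp⟩
  obtain ⟨v, l', hl', hw, hv, hvN⟩ := Nat.find_spec hex
  have hvlt : R.length v < N := hv ▸ (Nat.find_min' hex hp).trans_lt hlj
  have hvpos : ∀ m ∈ I, R.IsPositive (R.realRoot v m) := by
    intro m hm
    refine ih _ hvlt ?_ rfl
    by_contra hlt
    have hw' : w = v * R.simple m * R.wordProd (m :: l') := by
      rw [hw, wordProd_cons, ← mul_assoc, mul_simple_mul_simple]
    have h1 := R.length_mul_le (v * R.simple m) (R.wordProd (m :: l'))
    have h2 := R.length_wordProd_le (m :: l')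
    rw [← hw'] at h1
    simp only [List.length_cons] at h2
    refine Nat.find_min hex (m := R.length (v * R.simple m)) (by omega)
      ⟨_, m :: l', ?_, hw', rfl, by simp only [List.length_cons]; omega⟩
    rintro x (_ | ⟨_, hx⟩)
    · exact hm
    · exact hl' x hx
  have hsign : ∀ l'' : List (Fin n), (∀ m ∈ l'', m ∈ I) → ∀ m ∈ I,
      R.IsPositive (R.realRoot (R.wordProd l'') m) ∨
        R.IsPositive (-R.realRoot (R.wordProd l'') m) := by
    intro l'' hl'' m hm
    obtain ⟨p, q, e, ⟨hp, hq⟩ | ⟨hp, hq⟩⟩ := R.exists_coord_rank_two hij hl'' hm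
    · exact Or.inl (e ▸ ((R.isPositive_root i).zsmul hp).add ((R.isPositive_root j).zsmul hq))
    · refine Or.inr ?_
      rw [e, neg_add, ← neg_smul, ← neg_smul]
      exact ((R.isPositive_root i).zsmul (by omega)).add ((R.isPositive_root j).zsmul (by omega))
  obtain ⟨p, q, e, hpq⟩ := R.exists_coord_rank_two hij hl' hiI
  have hnn : 0 ≤ p ∧ 0 ≤ q := by
    rcases hpq with hpq | ⟨hp, hq⟩
    · exact hpq
    · -- otherwise the exchange property gives a shorter expression of `w s_i`
      obtain ⟨l'', -, h1, h2⟩ := R.exists_shorter_word hsign (lu := []) (by simp) hiI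
        (by simpa using R.isPositive_root i) hl' (by
          rw [wordProd_nil, mul_one, e, neg_add, ← neg_smul, ← neg_smul]
          exact ((R.isPositive_root i).zsmul (by omega)).add
            ((R.isPositive_root j).zsmul (by omega)))
      rw [wordProd_nil, refl_one] at h2
      have h3 := R.length_mul_le v (R.wordProd l'')
      have h4 := R.length_wordProd_le l''
      rw [h2, ← mul_assoc, ← hw] at h3
      rw [h2] at h4
      omega
  rw [hw, ← dualAct_realRoot, e, map_add, map_zsmul, map_zsmul, dualAct_root, dualAct_root]
  exact ((hvpos i hiI).zsmul hnn.1).add ((hvpos j hjI).zsmul hnn.2)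

/-- Every real root is positive or negative. -/
theorem isPositive_or_neg (u : R.Weyl) (i : Fin n) :
    R.IsPositive (R.realRoot u i) ∨ R.IsPositive (-R.realRoot u i) := by
  rcases le_total (R.length u) (R.length (u * R.simple i)) with h | h
  · exact Or.inl (R.isPositive_of_length_le h)
  · right
    rw [← realRoot_mul_simple_self]
    exact R.isPositive_of_length_le (by rwa [mul_simple_mul_simple])

/-- Every reflection is the reflection in a positive real root. -/
theorem exists_isPositive_refl (u : R.Weyl) (i : Fin n) :
    ∃ v, R.IsPositive (R.realRoot v i) ∧ R.refl v i = R.refl u i := by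
  rcases R.isPositive_or_neg u i with h | h
  · exact ⟨u, h, rfl⟩
  · exact ⟨u * R.simple i, by rwa [realRoot_mul_simple_self], R.refl_mul_simple_self u i⟩

/-! ### Length and the Bruhat order -/

/-- If `β > 0` and `x β < 0` then `x s_β` is shorter than `x`. -/
theorem length_mul_refl_lt {x u : R.Weyl} {i : Fin n} (hu : R.IsPositive (R.realRoot u i))
    (h : R.IsPositive (-R.realRoot (x * u) i)) : R.length (x * R.refl u i) < R.length x := by
  obtain ⟨l, hl, rfl⟩ := R.exists_reduced_word x
  obtain ⟨lu, rfl⟩ := R.exists_wordProd u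
  obtain ⟨l', -, h1, h2⟩ := R.exists_shorter_word (I := Set.univ)
    (fun l _ m _ => R.isPositive_or_neg _ m) (lu := lu) (by simp) (Set.mem_univ i) hu
    (l := l) (by simp) h
  rw [← h2, ← hl]
  exact (R.length_wordProd_le l').trans_lt h1

/-- If `β > 0` and `x β > 0` then `x s_β` is longer than `x`. -/
theorem lt_length_mul_refl {x u : R.Weyl} {i : Fin n} (hu : R.IsPositive (R.realRoot u i))
    (h : R.IsPositive (R.realRoot (x * u) i)) : R.length x < R.length (x * R.refl u i) := by
  have h1 : x * R.refl u i * u = x * u * R.simple i := by simp [refl, mul_assoc]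
  have := R.length_mul_refl_lt (x := x * R.refl u i) hu
    (by rwa [h1, realRoot_mul_simple_self, neg_neg])
  rwa [mul_assoc, refl_mul_refl, mul_one] at this

variable {R}

theorem BruhatStep.le {x y : R.Weyl} (h : R.BruhatStep x y) : x ≤ y :=
  Relation.ReflTransGen.single h

theorem BruhatStep.lt {x y : R.Weyl} (h : R.BruhatStep x y) : x < y :=
  lt_of_le_of_ne h.le fun e => (e ▸ h.2).false

theorem length_lt_of_lt {x y : R.Weyl} (h : x < y) : R.length x < R.length y :=
  (R.length_le_of_reflTransGen h.le).resolve_left h.ne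

theorem BruhatEdge.step {x y : R.Weyl} (h : R.BruhatEdge x y) : R.BruhatStep x y := by
  obtain ⟨hlt, ⟨u, i⟩, -, e⟩ := h
  exact ⟨⟨u, i, mul_inv_eq_iff_eq_mul.1 e⟩, length_lt_of_lt hlt⟩

theorem BruhatStep.edge {x y : R.Weyl} (h : R.BruhatStep x y) : R.BruhatEdge x y := by
  obtain ⟨u, i, e⟩ := h.1
  obtain ⟨v, hv, hvu⟩ := R.exists_isPositive_refl u i
  exact ⟨h.lt, (v, i), hv, by rw [hvu, e, mul_inv_cancel_right]⟩

theorem bruhatEdge_iff {x y : R.Weyl} : R.BruhatEdge x y ↔ R.BruhatStep x y :=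
  ⟨BruhatEdge.step, BruhatStep.edge⟩

theorem exists_edge_of_lt {x w : R.Weyl} (h : x < w) : ∃ y, R.BruhatEdge x y ∧ y ≤ w := by
  rcases Relation.ReflTransGen.cases_head h.le with e | ⟨y, hxy, hyw⟩
  · exact (h.ne e).elim
  · exact ⟨y, hxy.edge, hyw⟩

theorem BruhatStep.inv {x y : R.Weyl} (h : R.BruhatStep x y) : R.BruhatStep x⁻¹ y⁻¹ := by
  obtain ⟨⟨u, i, rfl⟩, h⟩ := h
  refine ⟨⟨x⁻¹ * u, i, ?_⟩, by rwa [length_inv, length_inv]⟩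
  have : (R.refl u i)⁻¹ = R.refl u i := inv_eq_of_mul_eq_one_left (R.refl_mul_refl u i)
  rw [refl_mul, mul_inv_rev, this]
  simp

theorem inv_le_inv_of_le {x y : R.Weyl} (h : x ≤ y) : x⁻¹ ≤ y⁻¹ :=
  Relation.ReflTransGen.lift (r := R.BruhatStep) (p := R.BruhatStep) (fun x => x⁻¹)
    (fun _ _ => BruhatStep.inv) _ _ (show Relation.ReflTransGen R.BruhatStep x y from h)

/-- Right multiplication by a simple reflection preserves the steps of the Bruhat order, except
that it may interchange the ends of a step. -/
theorem BruhatStep.mul_simple {x y : R.Weyl} (h : R.BruhatStep x y) (i : Fin n) :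
    y = x * R.simple i ∨ R.BruhatStep (x * R.simple i) (y * R.simple i) := by
  obtain ⟨⟨u, m, rfl⟩, hlt⟩ := h
  -- `t x = x t'` with `t'` the reflection in a positive root `β = v α_m`
  obtain ⟨v, hv, hvu⟩ := R.exists_isPositive_refl (x⁻¹ * u) m
  have hx : R.refl u m * x = x * R.refl v m := by
    rw [hvu, refl_mul]
    group
  have hxv : R.IsPositive (R.realRoot (x * v) m) := by
    refine (R.isPositive_or_neg (x * v) m).resolve_right fun h => ?_
    have := R.length_mul_refl_lt hv h
    rw [← hx] at this
    omega
  rcases R.isPositive_or_neg (R.simple i * v) m with h | h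
  · right
    refine ⟨⟨u, m, mul_assoc _ _ _⟩, ?_⟩
    have h1 := R.lt_length_mul_refl (x := x * R.simple i) h (by
      rwa [← mul_assoc, mul_simple_mul_simple])
    have h2 : R.refl u m * x * R.simple i = x * R.simple i * R.refl (R.simple i * v) m := by
      rw [hx, refl_mul]
      simp only [← mul_assoc, mul_simple_mul_simple, simple_inv]
    rwa [h2]
  · left
    rw [← dualAct_realRoot] at h
    rw [hx, R.refl_eq_simple (R.eq_root_of_isPositive hv h)]

/-- Either `w s_i < w` or `w < w s_i`. -/
theorem step_mul_simple (w : R.Weyl) (i : Fin n) :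
    R.BruhatStep w (w * R.simple i) ∨ R.BruhatStep (w * R.simple i) w := by
  have h1 : w * R.simple i = R.refl w i * w := by simp [refl]
  have h2 : w = R.refl w i * (w * R.simple i) := by simp [refl, mul_assoc]
  have hi : R.IsPositive (R.realRoot 1 i) := by simpa using R.isPositive_root i
  rcases R.isPositive_or_neg w i with h | h
  · have := R.lt_length_mul_refl (x := w) hi (by simpa using h)
    rw [refl_one] at this
    exact Or.inl ⟨⟨w, i, h1⟩, this⟩
  · have := R.length_mul_refl_lt (x := w) hi (by simpa using h)
    rw [refl_one] at this
    exact Or.inr ⟨⟨w, i, h2⟩, this⟩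

/-- A lifting property of the Bruhat order: multiply a chain of steps from `x` to `w` by `s_i`,
up to the first step that this reverses. -/
theorem le_mul_simple_or {x w : R.Weyl} (h : x ≤ w) (i : Fin n) :
    x ≤ w * R.simple i ∨ x * R.simple i ≤ w * R.simple i := by
  induction (show Relation.ReflTransGen R.BruhatStep x w from h) using
    Relation.ReflTransGen.head_induction_on with
  | refl => exact Or.inr le_rfl
  | head hxy hyw ih =>
    rcases ih hyw with h | h
    · exact Or.inl (hxy.le.trans h)
    · rcases hxy.mul_simple i with e | h'
      · rw [e, mul_simple_mul_simple] at h
        exact Or.inl h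
      · exact Or.inr (h'.le.trans h)

/-- A lifting property of the Bruhat order, obtained in the same way as `le_mul_simple_or`. -/
theorem mul_simple_le_or {x w : R.Weyl} (h : x ≤ w) (i : Fin n) :
    x * R.simple i ≤ w ∨ x * R.simple i ≤ w * R.simple i := by
  induction (show Relation.ReflTransGen R.BruhatStep x w from h) using
    Relation.ReflTransGen.head_induction_on with
  | refl => exact Or.inr le_rfl
  | head hxy hyw ih =>
    rcases hxy.mul_simple i with e | h'
    · exact Or.inl (e ▸ hyw)
    · exact (ih hyw).imp h'.le.trans h'.le.trans

/-! ### Right multiplication on intervals -/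

section interval

variable {y w : R.Weyl} {i : Fin n} (hw : w * R.simple i < w) (hy : ¬ y ≤ w * R.simple i)
include hy

theorem mul_simple_le_of_mem {z : R.Weyl} (hyz : y ≤ z) (hzw : z ≤ w) :
    z * R.simple i ≤ w * R.simple i :=
  (le_mul_simple_or hzw i).resolve_left fun h => hy (hyz.trans h)

/-- If `y ≰ w s_i`, then right multiplication by `s_i` shortens every element of `[y, w]`. -/
theorem step_of_mem {z : R.Weyl} (hyz : y ≤ z) (hzw : z ≤ w) :
    R.BruhatStep (z * R.simple i) z :=
  (step_mul_simple z i).resolve_left fun h =>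
    hy (hyz.trans (h.le.trans (mul_simple_le_of_mem hy hyz hzw)))

theorem mul_simple_le_mul_simple {z z' : R.Weyl} (hyz : y ≤ z) (hzz' : z ≤ z') (hzw : z' ≤ w) :
    z * R.simple i ≤ z' * R.simple i :=
  (le_mul_simple_or hzz' i).elim (fun h => (step_of_mem hy hyz (hzz'.trans hzw)).le.trans h) id

include hw

/-- If `w s_i < w` and `y ≰ w s_i`, then right multiplication by `s_i` lengthens every element of
`[y s_i, w s_i]` and maps it into `[y, w]`. -/
theorem mul_simple_mem {u : R.Weyl} (hyu : y * R.simple i ≤ u) (huw : u ≤ w * R.simple i) :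
    R.BruhatStep u (u * R.simple i) ∧ y ≤ u * R.simple i ∧ u * R.simple i ≤ w := by
  have h1 := mul_simple_le_or hyu i
  rw [mul_simple_mul_simple] at h1
  have h2 := mul_simple_le_or huw i
  rw [mul_simple_mul_simple] at h2
  have hstep : R.BruhatStep u (u * R.simple i) := by
    refine (step_mul_simple u i).resolve_right fun h => ?_
    rcases h1 with h1 | h1
    · exact hy (h1.trans huw)
    · exact hy ((h1.trans h.le).trans huw)
  exact ⟨hstep, h1.elim (fun h => h.trans hstep.le) id, h2.elim (fun h => h.trans hw.le) id⟩

theorem le_of_mul_simple_le {u u' : R.Weyl} (hyu : y * R.simple i ≤ u) (huu' : u ≤ u')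
    (huw : u' ≤ w * R.simple i) : u * R.simple i ≤ u' * R.simple i :=
  (mul_simple_le_or huu' i).elim
    (fun h => h.trans (mul_simple_mem hw hy (hyu.trans huu') huw).1.le) id

end interval

end Realisation

/-! ### Isomorphisms of Bruhat moment graphs -/

namespace Realisation
variable {n : ℕ} {C : CartanMat n} {𝔥 : Type v} [AddCommGroup 𝔥] [Module ℂ 𝔥]
  {R : Realisation C 𝔥}

/-- The automorphism of the coroot lattice given by an element of the Weyl group. -/
def latticeAut (u : R.Weyl) : R.corootLattice ≃ₗ[ℤ] R.corootLattice where
  toFun x := ⟨R.toGL u x, R.toGL_mem_corootLattice u x.2⟩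
  map_add' x y := Subtype.ext (map_add (R.toGL u) (x : 𝔥) y)
  map_smul' c x := Subtype.ext (map_zsmul (R.toGL u) c (x : 𝔥))
  invFun x := ⟨R.toGL u⁻¹ x, R.toGL_mem_corootLattice u⁻¹ x.2⟩
  left_inv x := Subtype.ext (R.toGL_inv_apply_self u x)
  right_inv x := Subtype.ext (R.toGL_apply_inv_self u x)

theorem coe_latticeAut (u : R.Weyl) (x : R.corootLattice) :
    (latticeAut u x : 𝔥) = R.toGL u x := rfl

theorem exists_label_eq {x y : R.Weyl} (h : R.bruhatGraph.Edge x y) :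
    ∃ u i, y * x⁻¹ = R.refl u i ∧ (R.bruhatGraph.label h : 𝔥) = R.realCoroot u i :=
  ⟨_, _, h.2.choose_spec.2, rfl⟩

theorem label_eq_or_eq_neg {x y : R.Weyl} (h : R.bruhatGraph.Edge x y) {u : R.Weyl} {i : Fin n}
    (e : y * x⁻¹ = R.refl u i) :
    R.realCoroot u i = R.bruhatGraph.label h ∨
      R.realCoroot u i = -(R.bruhatGraph.label h : 𝔥) := by
  obtain ⟨v, j, e', hl⟩ := exists_label_eq h
  rw [hl]
  exact R.realCoroot_eq_or_eq_neg (e.symm.trans e')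

/-- Inversion, as an isomorphism of Bruhat moment graphs up to automorphisms of the lattice. -/
def invIso (w : R.Weyl) :
    (R.bruhatGraphLE w).UpperIso (R.bruhatGraphLE w⁻¹) (Set.Iic w) where
  left := id
  right x := ⟨(x : R.Weyl)⁻¹, inv_le_inv_of_le x.2⟩
  g x := latticeAut (x : R.Weyl)⁻¹
  left_injective := Function.injective_id
  right_injective x y h := Subtype.ext (inv_injective (congrArg Subtype.val h))
  lt_iff {x y} := by
    have key : ∀ {x y : R.Weyl}, x < y → x⁻¹ < y⁻¹ := fun h =>
      lt_of_le_of_ne (inv_le_inv_of_le h.le) fun e => h.ne (inv_injective e)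
    refine ⟨key, fun h => ?_⟩
    have h' : (x : R.Weyl)⁻¹⁻¹ < (y : R.Weyl)⁻¹⁻¹ := key h
    rwa [inv_inv, inv_inv] at h'
  left_upper {_ v} _ := ⟨v, rfl⟩
  right_upper {_ v} _ := by
    have hv : (v : R.Weyl)⁻¹ ≤ w := by simpa using inv_le_inv_of_le v.2
    exact ⟨⟨_, hv⟩, Subtype.ext (inv_inv _)⟩
  edge_iff {x y} := by
    change R.BruhatEdge x y ↔ R.BruhatEdge (x : R.Weyl)⁻¹ (y : R.Weyl)⁻¹
    rw [bruhatEdge_iff, bruhatEdge_iff]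
    exact ⟨BruhatStep.inv, fun h => by simpa using h.inv⟩
  label {x y} h h' := by
    obtain ⟨u, i, e, hl⟩ := exists_label_eq (R := R) (x := x) (y := y) h
    have e' : (y : R.Weyl)⁻¹ * (x : R.Weyl)⁻¹⁻¹ = R.refl ((y : R.Weyl)⁻¹ * u) i := by
      rw [eq_comm, ← inv_inj, inv_eq_of_mul_eq_one_left (R.refl_mul_refl _ i), refl_mul, ← e]
      group
    have hg : (latticeAut (y : R.Weyl)⁻¹ ((R.bruhatGraphLE w).label h) : 𝔥) =
        R.realCoroot ((y : R.Weyl)⁻¹ * u) i := by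
      rw [coe_latticeAut, ← toGL_realCoroot, ← hl]
      rfl
    refine (label_eq_or_eq_neg (R := R) (x := (x : R.Weyl)⁻¹) (y := (y : R.Weyl)⁻¹) h' e').imp
      (fun e => Subtype.ext (hg.trans e)) fun e => Subtype.ext (hg.trans e)
  congr {x y} h l := by
    obtain ⟨u, i, e, hl⟩ := exists_label_eq (R := R) (x := (x : R.Weyl)⁻¹) (y := (y : R.Weyl)⁻¹) h
    obtain ⟨c, hc⟩ := R.root_apply_int i
      (R.toGL_mem_corootLattice u⁻¹ (R.toGL_mem_corootLattice (x : R.Weyl)⁻¹ l.2))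
    refine ⟨c, Subtype.ext ?_⟩
    change R.toGL (x : R.Weyl)⁻¹ l - R.toGL (y : R.Weyl)⁻¹ l =
      c • (R.bruhatGraph.label h : 𝔥)
    rw [hl, mul_inv_eq_iff_eq_mul.1 e, toGL_mul_apply, refl_apply, sub_sub_cancel,
      ← Int.cast_smul_eq_zsmul ℂ, ← hc]
    rfl

/-- Right multiplication by a simple reflection, as an isomorphism of the intervals `[y, w]` and
`[y s, w s]` in the Bruhat moment graph. -/
def mulSimpleIso {y w : R.Weyl} {i : Fin n} (hw : w * R.simple i < w)
    (hy : ¬ y ≤ w * R.simple i) :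
    (R.bruhatGraphLE w).UpperIso (R.bruhatGraphLE (w * R.simple i)) (Set.Icc y w) where
  left z := ⟨z, z.2.2⟩
  right z := ⟨z * R.simple i, mul_simple_le_of_mem hy z.2.1 z.2.2⟩
  g _ := LinearEquiv.refl ℤ _
  left_injective x z h := Subtype.ext (congrArg Subtype.val h :)
  right_injective x z h := Subtype.ext (mul_right_cancel (congrArg Subtype.val h :))
  lt_iff {x z} := by
    change (x : R.Weyl) < z ↔ (x : R.Weyl) * R.simple i < z * R.simple i
    constructor
    · exact fun h => lt_of_le_of_ne (mul_simple_le_mul_simple hy x.2.1 h.le z.2.2)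
        fun e => h.ne (mul_right_cancel e)
    · intro h
      have := le_of_mul_simple_le hw hy (mul_simple_le_mul_simple hy le_rfl x.2.1 x.2.2) h.le
        (mul_simple_le_of_mem hy z.2.1 z.2.2)
      rw [mul_simple_mul_simple, mul_simple_mul_simple] at this
      exact lt_of_le_of_ne this fun e => h.ne (by rw [e])
  left_upper {x v} h := ⟨⟨v, x.2.1.trans (show (x : R.Weyl) < v from h).le, v.2⟩, rfl⟩
  right_upper {x v} h := by
    have hv : (x : R.Weyl) * R.simple i < v := h
    have := mul_simple_mem hw hy
      ((mul_simple_le_mul_simple hy le_rfl x.2.1 x.2.2).trans hv.le) v.2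
    exact ⟨⟨v * R.simple i, this.2.1, this.2.2⟩, Subtype.ext (R.mul_simple_mul_simple _ _)⟩
  edge_iff {x z} := by
    change R.BruhatEdge x z ↔ R.BruhatEdge (x * R.simple i) (z * R.simple i)
    rw [bruhatEdge_iff, bruhatEdge_iff]
    constructor
    · refine fun h => (h.mul_simple i).resolve_left fun e => ?_
      have := step_of_mem hy x.2.1 x.2.2
      rw [← e] at this
      exact lt_asymm this.lt h.lt
    · intro h
      have h' := h.mul_simple i
      rw [mul_simple_mul_simple, mul_simple_mul_simple] at h'
      refine h'.resolve_left fun e => ?_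
      have := step_of_mem hy z.2.1 z.2.2
      have hx : (x : R.Weyl) * R.simple i = z := by rw [← e, mul_simple_mul_simple]
      rw [e] at this
      rw [hx, e] at h
      exact lt_asymm this.lt h.lt
  label {x z} h h' := by
    obtain ⟨u, j, e, hl⟩ := exists_label_eq (R := R) (x := x) (y := z) h
    have e' : (z : R.Weyl) * R.simple i * (x * R.simple i)⁻¹ = R.refl u j := by
      rw [← e]
      group
    refine (label_eq_or_eq_neg (R := R) (x := x * R.simple i) (y := z * R.simple i) h' e').imp
      (fun e => Subtype.ext (hl.trans e)) fun e => Subtype.ext (hl.trans e)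
  congr _ _ := ⟨0, by simp⟩

theorem exists_edge_Iic {w : R.Weyl} {x : Set.Iic w} (hx : (x : R.Weyl) ≠ w) :
    ∃ z, (R.bruhatGraphLE w).Edge x z := by
  obtain ⟨z, hz, hzw⟩ := exists_edge_of_lt (lt_of_le_of_ne x.2 hx)
  exact ⟨⟨z, hzw⟩, hz⟩

theorem isMax_Iic (w : R.Weyl) : IsMax (⟨w, Set.mem_Iic.2 le_rfl⟩ : Set.Iic w) :=
  fun z _ => z.2

theorem length_sub_lt {x z w : R.Weyl} (h : x < z) (hz : z ≤ w) :
    R.length w - R.length z < R.length w - R.length x := by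
  have h1 := length_lt_of_lt h
  have h2 : R.length z ≤ R.length w := by
    rcases R.length_le_of_reflTransGen hz with rfl | h
    · exact le_rfl
    · exact h.le
  omega

end Realisation

namespace GradedMod

variable {k : Type u} [CommRing k] {Y : Type v} [AddCommGroup Y] {M N P : GradedMod k Y}

theorem IsSemiIso.trans {g g' : Y ≃ₗ[ℤ] Y} {φ : M ≃+ N} {ψ : N ≃+ P} (hφ : IsSemiIso g φ)
    (hψ : IsSemiIso g' ψ) : IsSemiIso (g.trans g') (φ.trans ψ) where
  map_smul s m := by
    rw [AddEquiv.trans_apply, hφ.map_smul, hψ.map_smul]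
    exact congrArg (· • _) (symHom_comp_apply _ _ s)
  mem_deg i m := by rw [AddEquiv.trans_apply, hψ.mem_deg, hφ.mem_deg]

theorem IsSemiIso.isomorphic {φ : M ≃+ N} (hφ : IsSemiIso (LinearEquiv.refl ℤ Y) φ) :
    M.Isomorphic N :=
  ⟨{ φ with map_smul' := fun s m => (hφ.map_smul s m).trans (by rw [symMap_refl_apply]; rfl) },
    fun i m => (hφ.mem_deg i m).symm⟩

end GradedMod

/-! ### Isomorphisms of stalks -/

section Stalks

variable {n : ℕ} {C : CartanMat n} {𝔥 : Type v} [AddCommGroup 𝔥] [Module ℂ 𝔥]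
  {R : Realisation C 𝔥} {k : Type u} [CommRing k] {y w : R.Weyl}

open Realisation

theorem isomorphic_stalk_inv (hyw : y ≤ w) {B : Sheaf k (R.bruhatGraphLE w)}
    {B' : Sheaf k (R.bruhatGraphLE w⁻¹)} (hB : B.IsBradenMacPherson ⟨w, Set.mem_Iic.2 le_rfl⟩)
    (hB' : B'.IsBradenMacPherson ⟨w⁻¹, Set.mem_Iic.2 le_rfl⟩) :
    (B.stalk ⟨y, hyw⟩).Isomorphic (B'.stalk ⟨y⁻¹, inv_le_inv_of_le hyw⟩) := by
  by_cases e : y = w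
  · subst e
    obtain ⟨φ, hφ⟩ := Sheaf.exists_semiIso_of_isomorphicToSym hB.top_stalk hB'.top_stalk
      (LinearEquiv.refl ℤ _)
    exact hφ.isomorphic
  · obtain ⟨φ, hφ⟩ := Sheaf.exists_semiIso_stalk (invIso w) hB hB' (isMax_Iic w)
      (fun x => by
        by_cases hx : (x : R.Weyl) = w
        · exact Or.inl ⟨Subtype.ext hx, Subtype.ext (congrArg (·⁻¹) hx)⟩
        · exact Or.inr (exists_edge_Iic hx))
      (fun x => R.length w - R.length x) (fun {x z} h => length_sub_lt h z.2) ⟨y, hyw⟩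
    -- undo the twist by `y⁻¹`
    obtain ⟨z, hz⟩ := exists_edge_Iic (w := w⁻¹) (x := ⟨y⁻¹, inv_le_inv_of_le hyw⟩)
      (fun h => e (inv_injective h))
    obtain ⟨ψ, hψ⟩ := (hB'.projectiveCover hz).projective.exists_semiIso_self
      (latticeAut y⁻¹).symm
    have h := hφ.trans hψ
    rw [show ((invIso w).g ⟨y, hyw⟩).trans (latticeAut y⁻¹).symm = LinearEquiv.refl ℤ _ from
      LinearEquiv.self_trans_symm _] at h
    exact h.isomorphic

theorem isomorphic_stalk_mul_simple (hyw : y ≤ w) {i : Fin n} (hw : w * R.simple i < w)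
    (hy : ¬ y ≤ w * R.simple i) {B : Sheaf k (R.bruhatGraphLE w)}
    {B' : Sheaf k (R.bruhatGraphLE (w * R.simple i))}
    (hB : B.IsBradenMacPherson ⟨w, Set.mem_Iic.2 le_rfl⟩)
    (hB' : B'.IsBradenMacPherson ⟨w * R.simple i, Set.mem_Iic.2 le_rfl⟩) :
    (B.stalk ⟨y, hyw⟩).Isomorphic
      (B'.stalk ⟨y * R.simple i, mul_simple_le_of_mem hy le_rfl hyw⟩) := by
  obtain ⟨φ, hφ⟩ := Sheaf.exists_semiIso_stalk (mulSimpleIso hw hy) hB hB' (isMax_Iic w)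
    (fun x => by
      by_cases hx : (x : R.Weyl) = w
      · exact Or.inl ⟨Subtype.ext hx, Subtype.ext (congrArg (· * R.simple i) hx)⟩
      · obtain ⟨z, hz⟩ := exists_edge_Iic (w := w) (x := ⟨x, x.2.2⟩) hx
        exact Or.inr ⟨⟨z, x.2.1.trans hz.1.le, z.2⟩, hz⟩)
    (fun x => R.length w - R.length x) (fun {x z} h => length_sub_lt h z.2.2)
    ⟨y, le_rfl, hyw⟩
  exact hφ.isomorphic

end Stalks

end

end MomentSheaf

theorem theorem5p7 {n : ℕ} (C : MomentSheaf.CartanMat n)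
    {𝔥 : Type v} [AddCommGroup 𝔥] [Module ℂ 𝔥] (R : MomentSheaf.Realisation C 𝔥)
    (k : Type u) [CommRing k] [IsLocalRing k] (h_two : IsUnit (2 : k))
    (y w : R.Weyl) (hyw : y ≤ w) :
    (∃ h : y⁻¹ ≤ w⁻¹,
      ∀ (B : MomentSheaf.Sheaf k (R.bruhatGraphLE w))
        (B' : MomentSheaf.Sheaf k (R.bruhatGraphLE w⁻¹)),
        B.IsBradenMacPherson ⟨w, Set.mem_Iic.2 le_rfl⟩ → B'.IsBradenMacPherson ⟨w⁻¹, Set.mem_Iic.2 le_rfl⟩ →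
          (B.stalk ⟨y, hyw⟩).Isomorphic (B'.stalk ⟨y⁻¹, h⟩)) ∧
    (∀ i : Fin n, w * R.simple i < w → ¬ y ≤ w * R.simple i →
      ∃ h : y * R.simple i ≤ w * R.simple i,
        ∀ (B : MomentSheaf.Sheaf k (R.bruhatGraphLE w))
          (B' : MomentSheaf.Sheaf k (R.bruhatGraphLE (w * R.simple i))),
          B.IsBradenMacPherson ⟨w, Set.mem_Iic.2 le_rfl⟩ →
            B'.IsBradenMacPherson ⟨w * R.simple i, Set.mem_Iic.2 le_rfl⟩ →
              (B.stalk ⟨y, hyw⟩).Isomorphic (B'.stalk ⟨y * R.simple i, h⟩)) :=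
  ⟨⟨MomentSheaf.Realisation.inv_le_inv_of_le hyw,
    fun _ _ => MomentSheaf.isomorphic_stalk_inv hyw⟩,
    fun _ hw hy => ⟨MomentSheaf.Realisation.mul_simple_le_of_mem hy le_rfl hyw,
      fun _ _ => MomentSheaf.isomorphic_stalk_mul_simple hyw hw hy⟩⟩
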